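/- **Theorem 1 (security of PP-UFS).** *Setting.* Fix $N$ users, $m$ timeslots and a positive integer scaling factor $S$ that makes the scaled shares $S/t$ exact, i.e. $t \mid S$ for all $1\le t\le N$. User $i$ has a private schedule $b_i=(b_i^1,\dots,b_i^m)\in\{0,1\}^m$. Put $N^j=\sum_i b_i^j$ and $c^j=\bigvee_i b_i^j$. For security parameter $k$, the key is a uniformly random pair of distinct $k$-bit primes $p,q$ with $\gcd(pq,(p-1)(q-1))=1$; $n=pq$ is the public key, known to everybody, and $(p,q)$ is the private key, known to all users but not to the operator. Encryption is Paillier's, $\mathbb E[x]=(1+n)^x r^n \bmod n^2$ with fresh uniform $r\in\mathbb Z_n^*$ in every encryption, and $\mathbb D$ is decryption, read as an integer of least absolute value where an integer is needed. All masks $R^j$, $R_i^j$ are chosen by the operator, uniformly and independently in $\mathbb Z_n$. A rational number $y$ is encoded as the plaintext $\lfloor Sy\rfloor \bmod n$ in Stage 2. *Protocol PP-UFS (for every timeslot $j$).* Stage 1: each user $i$ sends $e_i^j=\mathbb E[b_i^j]$ to the operator; the operator returns $\big(\prod_{i'} e_{i'}^j\big)\cdot\mathbb E[R^j]\cdot (e_i^j)^{-R^j}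 \bmod n^2$ to user $i$, who decrypts it; if $b_i^j=1$, his result is the decrypted value $x_i^j$. Stage 2: the operator sends $R_i^j$ to user $i$; user $i$ sends $E_i^j=\mathbb E[\lfloor S(1/x_i^j+R_i^j)\rfloor]$ if $b_i^j=1$, and $E_i^j=\mathbb E[\lfloor S R_i^j\rfloor]$ if $b_i^j=0$; the operator sends $\prod_i E_i^j \bmod n^2$ to all users; each user decrypts it and returns the result $D^j$; the operator outputs $1$ if $D^j-S\sum_i R_i^j\equiv S \pmod n$, and $0$ otherwise. The view of a party consists of its input, the keys it knows, its coins, and all messages it receives. *Claim.* All parties are semi-honest (they follow the protocol) and do not collude. Assume that this Paillier cryptosystem is semantically secure: no probabilistic polynomial-time adversary with polynomial-length advice distinguishes encryptions of two messages of its choice with non-negligible advantage in $k$. Then: 1. (Correctness) If $S<2^{k-1}$, then in every execution the operator's output for timeslot $j$ is $c^j$, and the result of a user $i$ is $N^j$ for every $j$ with $b_i^j=1$. 2. (Operator) The operator learns only $c=(c^1,\dots,c^m)$: there is a probabilistic polynomial-time simulator which, given $k$, the public key and $c$, produces an output that is computationally indistinguishable from the operator's view, for all sequences (indexed by $k$)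 of schedules of the users. 3. (Users) User $i$ learns only $N^j$ for the timeslots $j$ with $b_i^j=1$, and nothing for the other timeslots: there is a probabilistic polynomial-time simulator which, given $k$, the keys, $b_i$, and $N^j$ for exactly those $j$ with $b_i^j=1$, produces an output that is computationally indistinguishable from the view of user $i$, for all sequences (indexed by $k$) of schedules of the users. Here computational indistinguishability is over the random key and all coins, against probabilistic polynomial-time distinguishers with polynomial-length advice, with advantage negligible in $k$. -/

import Mathlib

/-!
# Definitions

1. probabilistic polynomial-time programs and negligible functions;
2. the Paillier cryptosystem and its semantic security;
3. the uncapacitated facility sharing problem and the PP-UFS protocol;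
4. the views of the parties and computational indistinguishability.
-/

noncomputable section

namespace PPUFS

/-! ## 1. Probabilistic polynomial-time computation

While-programs over finitely many registers holding natural numbers. No single instruction makes a
number more than one bit longer than its operands (up to a constant of the program), and every
instruction is computable in time polynomial in the bit length of its operands. So a run with
polynomially many instructions is a polynomial-time computation in the usual sense; conversely, a
Turing machine is simulated by keeping its tape in registers, with a constant number of
instructions for each step. -/

/-- The contents of the registers. -/
abbrev State := ℕ → ℕ

/-- Programs; `x y z w` are names of registers. -/
inductive Cmd : Type
  /-- `x := v` -/
  | const (x v : ℕ) : Cmd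
  /-- `x := y + z` -/
  | add (x y z : ℕ) : Cmd
  /-- `x := max (y - z) 0` -/
  | sub (x y z : ℕ) : Cmd
  /-- `x := ⌊y / z⌋` (`0` if `z = 0`) -/
  | div (x y z : ℕ) : Cmd
  /-- `x := y * z mod w` (`0` if `w = 0`) -/
  | mulMod (x y z w : ℕ) : Cmd
  /-- `x := y ^ z mod w` (`0` if `w = 0`), computable by repeated squaring -/
  | powMod (x y z w : ℕ) : Cmd
  /-- `x :=` a fresh uniformly random element of `{0, …, y}` -/
  | rand (x y : ℕ) : Cmd
  /-- first `c`, then `d` -/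
  | seq (c d : Cmd) : Cmd
  /-- if `x ≠ 0` then `c` else `d` -/
  | ite (x : ℕ) (c d : Cmd) : Cmd
  /-- while `x ≠ 0` do `c` -/
  | loop (x : ℕ) (c : Cmd) : Cmd

/-- The registers that a program mentions. -/
def Cmd.vars : Cmd → Finset ℕ
  | .const x _ => {x}
  | .add x y z => {x, y, z}
  | .sub x y z => {x, y, z}
  | .div x y z => {x, y, z}
  | .mulMod x y z w => {x, y, z, w}
  | .powMod x y z w => {x, y, z, w}
  | .rand x y => {x, y}
  | .seq c d => c.vars ∪ d.vars
  | .ite x c d => {x} ∪ c.vars ∪ d.vars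
  | .loop x c => {x} ∪ c.vars

/-- A configuration: the commands still to be executed, and the registers. The machine has halted
when no command is left. -/
abbrev Config := List Cmd × State

/-- One step of computation. -/
def step : Config → PMF Config
  | ([], s) => PMF.pure ([], s)
  | (.const x v :: K, s) => PMF.pure (K, Function.update s x v)
  | (.add x y z :: K, s) => PMF.pure (K, Function.update s x (s y + s z))
  | (.sub x y z :: K, s) => PMF.pure (K, Function.update s x (s y - s z))
  | (.div x y z :: K, s) => PMF.pure (K, Function.update s x (s y / s z))
  | (.mulMod x y z w :: K, s) =>
      PMF.pure (K, Function.update s x (if s w = 0 then 0 else (s y * s z) % s w))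
  | (.powMod x y z w :: K, s) =>
      PMF.pure (K, Function.update s x (if s w = 0 then 0 else (s y ^ s z) % s w))
  | (.rand x y :: K, s) =>
      (PMF.uniformOfFintype (Fin (s y + 1))).map fun v : Fin (s y + 1) =>
        (K, Function.update s x v.val)
  | (.seq c d :: K, s) => PMF.pure (c :: d :: K, s)
  | (.ite x c d :: K, s) => PMF.pure (if s x ≠ 0 then c :: K else d :: K, s)
  | (.loop x c :: K, s) => PMF.pure (if s x ≠ 0 then c :: .loop x c :: K else K, s)

/-- The distribution of the configuration after `t` steps. -/
def steps : ℕ → Config → PMF Config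
  | 0, C => PMF.pure C
  | t + 1, C => (step C).bind (steps t)

/-- The bit length of the data that a program can see when it is started in `s`. -/
def inputSize (c : Cmd) (s : State) : ℕ := ∑ x ∈ c.vars, Nat.size (s x)

/-- A probabilistic polynomial-time program: on all inputs and for all outcomes of its coins, it
halts within a number of steps that is polynomial in the bit length of its input. -/
structure PPT where
  prog : Cmd
  time : Polynomial ℕ
  halts : ∀ s : State, ∀ C ∈ (steps (time.eval (inputSize prog s)) ([prog], s)).support, C.1 = []

/-- The distribution of the final registers. -/
def PPT.run (A : PPT) (s : State) : PMF State :=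
  (steps (A.time.eval (inputSize A.prog s)) ([A.prog], s)).map Prod.snd

/-- The initial state that holds the given list of numbers; all other registers are zero. -/
def load (l : List ℕ) : State := fun x => l.getD x 0

/-- Auxiliary input (advice) of polynomial length, one string for each security parameter. -/
structure Advice where
  val : ℕ → ℕ
  bound : Polynomial ℕ
  size_le : ∀ k, Nat.size (val k) ≤ bound.eval k

/-- A negligible function of the security parameter. -/
def Negligible (f : ℕ → ℝ) : Prop :=
  Asymptotics.SuperpolynomialDecay Filter.atTop (fun k : ℕ => (k : ℝ)) f

/-! ## 2. The Paillier cryptosystem -/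

/-- `p, q` are admissible primes for security parameter `k`: distinct primes of exactly `k` bits
with `gcd (p q, (p - 1) (q - 1)) = 1`. -/
def IsKeyPair (k p q : ℕ) : Prop :=
  p.Prime ∧ q.Prime ∧ p ≠ q ∧ Nat.size p = k ∧ Nat.size q = k ∧
    Nat.Coprime (p * q) ((p - 1) * (q - 1))

/-- Key pairs for security parameter `k`: the private key is `(p, q)`, the public key `p q`. -/
def KeyPair (k : ℕ) : Type :=
  {pq : Fin (2 ^ k) × Fin (2 ^ k) // IsKeyPair k pq.1 pq.2}

instance (k : ℕ) : Finite (KeyPair k) := by unfold KeyPair; infer_instance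

instance (k : ℕ) : Fintype (KeyPair k) := Fintype.ofFinite _

namespace KeyPair

variable {k : ℕ} (K : KeyPair k)

def p : ℕ := K.1.1
def q : ℕ := K.1.2
/-- The public modulus. -/
def n : ℕ := K.p * K.q

instance : NeZero K.n := ⟨Nat.mul_ne_zero K.2.1.ne_zero K.2.2.1.ne_zero⟩

/-- Plaintexts are the integers modulo `n`. -/
abbrev Plain := ZMod K.n
/-- The randomness of an encryption is an invertible residue modulo `n`. -/
abbrev Nonce := (ZMod K.n)ˣ
/-- Ciphertexts are integers modulo `n ^ 2`. -/
abbrev Cipher := ZMod (K.n ^ 2)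

/-- Encryption `(1 + n) ^ x * r ^ n mod n ^ 2`. -/
def enc (x : K.Plain) (r : K.Nonce) : K.Cipher :=
  (1 + (K.n : K.Cipher)) ^ x.val * ((r : ZMod K.n).val : K.Cipher) ^ K.n

/-- Decryption `L (c ^ l mod n ^ 2) * l⁻¹ mod n`, with `l = (p - 1) (q - 1)` and
`L u = (u - 1) / n`. -/
def dec (c : K.Cipher) : K.Plain :=
  ((((c ^ ((K.p - 1) * (K.q - 1))).val - 1) / K.n : ℕ) : ZMod K.n) *
    (((K.p - 1) * (K.q - 1) : ℕ) : ZMod K.n)⁻¹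

end KeyPair

/-- Expectation over a uniformly random key pair for security parameter `k`. -/
def keyAvg (k : ℕ) (f : KeyPair k → ℝ) : ℝ := (∑ K, f K) / Fintype.card (KeyPair k)

/-- The probability that the output, which is register `0`, is `1`. -/
def acceptProb (μ : PMF State) : ℝ := (μ.map (fun s => decide (s 0 = 1)) true).toReal

/-- The semantic security experiment. The first phase of the adversary gets the security
parameter, its advice and the public key, and leaves two messages in registers `0` and `1`. The
second phase continues from the registers of the first, with an encryption of the message selected
by `β` in register `0`. -/
def challenge (A₁ A₂ : PPT) (z : Advice) (β : Bool) (k : ℕ) (K : KeyPair k) : PMF State :=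
  (A₁.run (load [k, z.val k, K.n, K.n ^ 2])).bind fun s =>
    (PMF.uniformOfFintype K.Nonce).bind fun r =>
      A₂.run (Function.update s 0 (K.enc ((if β then s 1 else s 0 : ℕ) : ZMod K.n) r).val)

/-- Semantic security (indistinguishability of encryptions under chosen plaintexts): no
probabilistic polynomial-time adversary with advice can tell encryptions of two messages of its
choice apart with non-negligible advantage. -/
def PaillierSemanticallySecure : Prop :=
  ∀ (A₁ A₂ : PPT) (z : Advice), Negligible fun k =>
    |keyAvg k (fun K => acceptProb (challenge A₁ A₂ z false k K)) -
      keyAvg k (fun K => acceptProb (challenge A₁ A₂ z true k K))|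

/-! ## 3. Uncapacitated facility sharing and the PP-UFS protocol -/

/-- Usage schedules: `b i j` says whether user `i` requests timeslot `j`. -/
abbrev Schedule (N m : ℕ) := Fin N → Fin m → Bool

/-- The number of users who request timeslot `j`. -/
def count {N m : ℕ} (b : Schedule N m) (j : Fin m) : ℕ :=
  (Finset.univ.filter fun i => b i j = true).card

/-- What the operator is to be given: whether any user requests timeslot `j`. -/
def occupancy {N m : ℕ} (b : Schedule N m) (j : Fin m) : Bool := decide (∃ i, b i j = true)

/-- What user `i` is to be given: the number of requesting users if `i` requests timeslot `j`, and
nothing otherwise. -/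
def share {N m : ℕ} (b : Schedule N m) (i : Fin N) (j : Fin m) : Option ℕ :=
  if b i j then some (count b j) else none

section Protocol

variable {k : ℕ} (K : KeyPair k) (N m S : ℕ)

/-- The operator's coins: the masks `R^j` of the first stage, the randomness for encrypting them,
and the masks `R_i^j` of the second stage. -/
abbrev OperatorCoins :=
  (Fin m → K.Plain) × (Fin m → K.Nonce) × (Fin N → Fin m → K.Plain)

/-- A user's coins: the randomness of his encryptions in the first and in the second stage. -/
abbrev UserCoins := (Fin m → K.Nonce) × (Fin m → K.Nonce)

/-- All coins of an execution. They are uniformly distributed. -/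
abbrev Coins := OperatorCoins K N m × (Fin N → UserCoins K m)

end Protocol

/-- The encoding of a rational number as a plaintext: scale by `S` and round down. Negative numbers
are represented modulo `n`. -/
def encode (S n : ℕ) (y : ℚ) : ZMod n := ((⌊(S : ℚ) * y⌋ : ℤ) : ZMod n)

section Execution

variable {k : ℕ} (K : KeyPair k) {N m : ℕ} (S : ℕ) (b : Schedule N m) (w : Coins K N m)

/-- Operator's mask for timeslot `j`, first stage. -/
def mask (j : Fin m) : K.Plain := w.1.1 j
/-- Operator's encryption randomness for timeslot `j`. -/
def maskNonce (j : Fin m) : K.Nonce := w.1.2.1 j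
/-- Operator's mask for user `i` and timeslot `j`, second stage; it is sent to user `i`. -/
def userMask (i : Fin N) (j : Fin m) : K.Plain := w.1.2.2 i j
/-- Encryption randomness of user `i`, first stage. -/
def nonce₁ (i : Fin N) (j : Fin m) : K.Nonce := (w.2 i).1 j
/-- Encryption randomness of user `i`, second stage. -/
def nonce₂ (i : Fin N) (j : Fin m) : K.Nonce := (w.2 i).2 j

/-- Stage 1, user `i` to operator: the encrypted request. -/
def request (i : Fin N) (j : Fin m) : K.Cipher :=
  K.enc (if b i j then 1 else 0) (nonce₁ K w i j)

/-- Stage 1, operator to user `i`: the product of all requests, times the encrypted mask, times the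
request of `i` to the power of minus the mask. -/
def reply (i : Fin N) (j : Fin m) : K.Cipher :=
  (∏ i', request K b w i' j) * K.enc (mask K w j) (maskNonce K w j) *
    (request K b w i j)⁻¹ ^ (mask K w j).val

/-- Stage 1: what user `i` decrypts, read as an integer of least absolute value. -/
def received (i : Fin N) (j : Fin m) : ℤ := (K.dec (reply K b w i j)).valMinAbs

/-- Stage 2, user `i` to operator: the encrypted masked share, where `1 / N^j` is computed from what
the user decrypted in the first stage. -/
def contribution (i : Fin N) (j : Fin m) : K.Cipher :=
  K.enc (encode S K.n
    ((if b i j then 1 / (received K b w i j : ℚ) else 0) + ((userMask K w i j).val : ℚ)))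
    (nonce₂ K w i j)

/-- Stage 2, operator to all users: the product of the contributions. -/
def aggregate (j : Fin m) : K.Cipher := ∏ i, contribution K S b w i j

/-- Stage 2, user `i` to operator: the decrypted aggregate. Every user decrypts the same
ciphertext. -/
def opened (_i : Fin N) (j : Fin m) : K.Plain := K.dec (aggregate K S b w j)

/-- The operator's result: a timeslot is used if the returned values, less the sum of the masks, are
the encoding of `1`. -/
def operatorOutput (j : Fin m) : Bool :=
  decide (∃ i, opened K S b w i j - encode S K.n (∑ i', ((userMask K w i' j).val : ℚ)) =
    encode S K.n 1)

/-- The result of user `i`. -/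
def userOutput (i : Fin N) (j : Fin m) : Option ℤ :=
  if b i j then some (received K b w i j) else none

end Execution

/-! ## 4. Views and indistinguishability -/

/-- A table of numbers as a list. -/
def tableList {N m : ℕ} (f : Fin N → Fin m → ℕ) : List ℕ :=
  (List.ofFn fun i => List.ofFn (f i)).flatten

/-- The operator's view of an execution: the public key, his coins, and all messages that he
receives. -/
def operatorTranscript {k : ℕ} (K : KeyPair k) {N m : ℕ} (S : ℕ) (b : Schedule N m)
    (w : Coins K N m) : List ℕ :=
  [K.n, K.n ^ 2]
    ++ List.ofFn (fun j => (mask K w j).val)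
    ++ List.ofFn (fun j => (maskNonce K w j : ZMod K.n).val)
    ++ tableList (fun i j => (userMask K w i j).val)
    ++ tableList (fun i j => (request K b w i j).val)
    ++ tableList (fun i j => (contribution K S b w i j).val)
    ++ tableList (fun i j => (opened K S b w i j).val)

/-- The view of user `i` of an execution: the public and the private key, his input, his coins, and
all messages that he receives. -/
def userTranscript {k : ℕ} (K : KeyPair k) {N m : ℕ} (S : ℕ) (b : Schedule N m) (i : Fin N)
    (w : Coins K N m) : List ℕ :=
  [K.n, K.n ^ 2, K.p, K.q]
    ++ List.ofFn (fun j => if b i j then 1 else 0)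
    ++ List.ofFn (fun j => (nonce₁ K w i j : ZMod K.n).val)
    ++ List.ofFn (fun j => (nonce₂ K w i j : ZMod K.n).val)
    ++ List.ofFn (fun j => (reply K b w i j).val)
    ++ List.ofFn (fun j => (userMask K w i j).val)
    ++ List.ofFn (fun j => (aggregate K S b w j).val)

/-- The distribution of the operator's view. -/
def operatorView {N m : ℕ} (S : ℕ) (b : Schedule N m) {k : ℕ} (K : KeyPair k) : PMF (List ℕ) :=
  (PMF.uniformOfFintype (Coins K N m)).map (operatorTranscript K S b)

/-- The distribution of the view of user `i`. -/
def userView {N m : ℕ} (S : ℕ) (b : Schedule N m) (i : Fin N) {k : ℕ} (K : KeyPair k) :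
    PMF (List ℕ) :=
  (PMF.uniformOfFintype (Coins K N m)).map (userTranscript K S b i)

/-- The list of numbers in registers `0, …, L - 1` at the end of a run of `A` on the input `l`. -/
def PPT.output (A : PPT) (L : ℕ) (l : List ℕ) : PMF (List ℕ) :=
  (A.run (load l)).map fun s => List.ofFn fun x : Fin L => s x

/-- What a simulator for the operator outputs, given the security parameter, the public key and
some bits `c`. -/
def operatorSim {m : ℕ} (A : PPT) (L : ℕ) (c : Fin m → Bool) {k : ℕ} (K : KeyPair k) :
    PMF (List ℕ) :=
  A.output L ([k, K.n, K.n ^ 2] ++ List.ofFn fun j => if c j then 1 else 0)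

/-- What a simulator for a user outputs, given the security parameter, the keys, the user's
schedule `u` and the user's result `a`. -/
def userSim {m : ℕ} (A : PPT) (L : ℕ) (u : Fin m → Bool) (a : Fin m → Option ℕ) {k : ℕ}
    (K : KeyPair k) : PMF (List ℕ) :=
  A.output L ([k, K.n, K.n ^ 2, K.p, K.q] ++ List.ofFn (fun j => if u j then 1 else 0)
    ++ List.ofFn fun j => (a j).getD 0)

/-- Computational indistinguishability, for a uniformly random key pair, against probabilistic
polynomial-time distinguishers with advice. -/
def CompIndist (X Y : (k : ℕ) → KeyPair k → PMF (List ℕ)) : Prop :=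
  ∀ (D : PPT) (z : Advice), Negligible fun k =>
    |keyAvg k (fun K => acceptProb ((X k K).bind fun v => D.run (load (k :: z.val k :: v)))) -
      keyAvg k (fun K => acceptProb ((Y k K).bind fun v => D.run (load (k :: z.val k :: v))))|

end PPUFS

end

namespace PPUFS

/-! ## Straight-line programs -/

/-! Paillier encryption is additively homomorphic, so both ciphertexts that a user receives are
again encryptions. By `reply_eq`, the first carries N^j + (1 - b_i^j) R^j: the mask cancels exactly
for a requesting user. By `aggregate_eq`, the second carries S (c^j + Σ R_i^j): the scaled shares S
/ N^j are integers, and N^j of them add up to S. The bound S < 2^(k-1) ≤ min(p, q) gives 2 N ≤ n, so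
that N^j is read off correctly, and S ≢ 0 mod n, so that the operator can tell the two cases apart.

Operator. Adding a known mask to a ciphertext is multiplication by a power of 1 + n, which needs no
key (`enc_add_natCast_val`). Hence by `operatorTranscript_eq` his view is computed from his coins,
the bits c^j, and encryptions of the requests and of the unmasked scaled shares. A hybrid argument
(`encView_indist`) replaces these encryptions by encryptions of zero, one at a time, each step being
a reduction to semantic security. Schedules may vary with k, but there are only finitely many, so
the sum of their advantages is one negligible bound for all sequences.

User. No assumption on the cryptosystem is used. What a user sees of the coins of the others can
serve as new coordinates: the masked count, the nonce of the reply, and the plaintext and nonce of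
the aggregate. The change of coordinates `visibleCoins` is injective (S is invertible mod n), hence
a permutation of the finite set of coins, and preserves the uniform distribution. So for large k the
view is exactly a function of fresh uniform coins and the permitted data (`userView_eq`). A lone
user computes the aggregate plaintext himself.

Machines. N, m and S are fixed, so simulators and reductions are straight-line programs of constant
length, compiled from arithmetic terms (`ArithList.exists_randomized`). They draw residues mod n
where the protocol draws units. Since 1 - φ(n)/n ≤ 1/p + 1/q ≤ 4/2^k, each such replacement costs a
negligible amount (`Sample.abs_expect_sub_le`). -/

/-- Programs without branches and loops. -/
inductive Straight : Cmd → Prop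
  | const (x v : ℕ) : Straight (.const x v)
  | add (x y z : ℕ) : Straight (.add x y z)
  | sub (x y z : ℕ) : Straight (.sub x y z)
  | div (x y z : ℕ) : Straight (.div x y z)
  | mulMod (x y z w : ℕ) : Straight (.mulMod x y z w)
  | powMod (x y z w : ℕ) : Straight (.powMod x y z w)
  | rand (x y : ℕ) : Straight (.rand x y)
  | seq {c d : Cmd} : Straight c → Straight d → Straight (.seq c d)

/-- The distribution of the registers after a straight-line program. -/
noncomputable def denote : Cmd → State → PMF State
  | .seq c d, s => (denote c s).bind (denote d)
  | c, s => (step ([c], s)).map Prod.snd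

/-- The number of steps of a straight-line program. -/
def cost : Cmd → ℕ
  | .seq c d => cost c + cost d + 1
  | _ => 1

theorem denote_seq (c d : Cmd) (s : State) :
    denote (.seq c d) s = (denote c s).bind (denote d) := by
  simp only [denote]

theorem denote_const (x v : ℕ) (s : State) :
    denote (.const x v) s = PMF.pure (Function.update s x v) := by
  simp [denote, step, PMF.pure_map]

theorem denote_add (x y z : ℕ) (s : State) :
    denote (.add x y z) s = PMF.pure (Function.update s x (s y + s z)) := by
  simp [denote, step, PMF.pure_map]

theorem denote_sub (x y z : ℕ) (s : State) :
    denote (.sub x y z) s = PMF.pure (Function.update s x (s y - s z)) := by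
  simp [denote, step, PMF.pure_map]

theorem denote_div (x y z : ℕ) (s : State) :
    denote (.div x y z) s = PMF.pure (Function.update s x (s y / s z)) := by
  simp [denote, step, PMF.pure_map]

theorem denote_mulMod (x y z w : ℕ) (s : State) :
    denote (.mulMod x y z w) s =
      PMF.pure (Function.update s x (if s w = 0 then 0 else (s y * s z) % s w)) := by
  simp [denote, step, PMF.pure_map]

theorem denote_powMod (x y z w : ℕ) (s : State) :
    denote (.powMod x y z w) s =
      PMF.pure (Function.update s x (if s w = 0 then 0 else (s y ^ s z) % s w)) := by
  simp [denote, step, PMF.pure_map]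

theorem denote_rand (x y : ℕ) (s : State) :
    denote (.rand x y) s =
      (PMF.uniformOfFintype (Fin (s y + 1))).map fun v => Function.update s x v.val := by
  simp [denote, step, PMF.map_comp, Function.comp_def]

theorem steps_succ (t : ℕ) (C : Config) : steps (t + 1) C = (step C).bind (steps t) := rfl

theorem steps_add (t u : ℕ) (C : Config) : steps (t + u) C = (steps t C).bind (steps u) := by
  induction t generalizing C with
  | zero => simp [steps]
  | succ t ih => rw [Nat.succ_add, steps_succ, steps_succ, PMF.bind_bind, funext ih]

theorem steps_halted (t : ℕ) (s : State) : steps t ([], s) = PMF.pure ([], s) := by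
  induction t with
  | zero => rfl
  | succ t ih => rw [steps_succ, step, PMF.pure_bind, ih]

/-- Halted configurations are fixed points. This allows a program to be run with a time budget that
is only an upper bound. -/
theorem steps_of_le {t u : ℕ} (h : t ≤ u) {C : Config}
    (hC : ∀ C' ∈ (steps t C).support, C'.1 = []) : steps u C = steps t C := by
  obtain ⟨d, rfl⟩ := Nat.exists_eq_add_of_le h
  rw [steps_add]
  conv_rhs => rw [← PMF.bind_pure (steps t C)]
  ext D
  simp only [PMF.bind_apply]
  refine tsum_congr fun C' => ?_
  by_cases h0 : C' ∈ (steps t C).support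
  · obtain ⟨l, s⟩ := C'
    obtain rfl : l = [] := hC _ h0
    rw [steps_halted]
  · rw [PMF.apply_eq_zero_iff _ _ |>.2 h0, zero_mul, zero_mul]

/-- Without branches the running time does not depend on the registers or the coins, so the count is
exact and the pending commands `K` are reached at a known time. -/
theorem Straight.steps {c : Cmd} (hc : Straight c) (K : List Cmd) (s : State) (t : ℕ) :
    steps (cost c + t) (c :: K, s) = (denote c s).bind fun s' => PPUFS.steps t (K, s') := by
  induction hc generalizing K s t with
  | seq _ _ ihc ihd =>
    rename_i c d _ _
    have : cost (.seq c d) + t = cost c + (cost d + t) + 1 := by simp only [cost]; ring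
    rw [this, steps_succ, step, PMF.pure_bind, ihc, denote_seq, PMF.bind_bind]
    simp only [ihd]
  | rand x y =>
    rw [cost, Nat.add_comm, steps_succ, step, denote_rand, PMF.bind_map, PMF.bind_map]
    · rfl
    all_goals simp
  | _ =>
    rw [cost, Nat.add_comm, steps_succ, step, PMF.pure_bind]
    · simp [denote_const, denote_add, denote_sub, denote_div, denote_mulMod, denote_powMod]
    all_goals simp

/-! ### Growth of register lengths and polynomial running time. -/

theorem sum_size_update_le (V : Finset ℕ) (s : State) (x v : ℕ) :
    ∑ y ∈ V, Nat.size (Function.update s x v y) ≤ ∑ y ∈ V, Nat.size (s y) + Nat.size v := by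
  have h : ∀ y ∈ V, Nat.size (Function.update s x v y) ≤
      Nat.size (s y) + if y = x then Nat.size v else 0 := by
    intro y _
    by_cases h : y = x
    · subst h; simp
    · simp [h]
  refine (Finset.sum_le_sum h).trans ?_
  rw [Finset.sum_add_distrib, Finset.sum_ite_eq']
  split <;> simp

theorem size_add_le (a b : ℕ) : Nat.size (a + b) ≤ Nat.size a + Nat.size b + 1 := by
  rw [Nat.size_le]
  have ha := Nat.lt_size_self a
  have hb := Nat.lt_size_self b
  have h1 : 2 ^ a.size ≤ 2 ^ (a.size + b.size) := Nat.pow_le_pow_right (by norm_num) (by omega)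
  have h2 : 2 ^ b.size ≤ 2 ^ (a.size + b.size) := Nat.pow_le_pow_right (by norm_num) (by omega)
  rw [pow_succ]
  omega

theorem ite_mod_le (a b : ℕ) : (if b = 0 then 0 else a % b) ≤ b := by
  split
  · simp
  · exact (Nat.mod_lt _ (by omega)).le

/-- A straight-line program increases the total length of the registers at most linearly. -/
theorem Straight.size_le {c : Cmd} (hc : Straight c) {V : Finset ℕ} (hV : c.vars ⊆ V) :
    ∃ a b : ℕ, ∀ s, ∀ s' ∈ (denote c s).support,
      ∑ x ∈ V, Nat.size (s' x) ≤ a * ∑ x ∈ V, Nat.size (s x) + b := by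
  have hmem : ∀ s : State, ∀ y ∈ V, Nat.size (s y) ≤ ∑ x ∈ V, Nat.size (s x) := fun s y hy =>
    Finset.single_le_sum (f := fun x => Nat.size (s x)) (fun _ _ => Nat.zero_le _) hy
  induction hc with
  | seq _ _ ihc ihd =>
    obtain ⟨a, b, h⟩ := ihc (Finset.union_subset_left hV)
    obtain ⟨a', b', h'⟩ := ihd (Finset.union_subset_right hV)
    refine ⟨a' * a, a' * b + b', fun s s' hs' => ?_⟩
    rw [denote_seq, PMF.mem_support_bind_iff] at hs'
    obtain ⟨u, hu, hs'⟩ := hs'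
    refine (h' u s' hs').trans ?_
    have := Nat.mul_le_mul_left a' (h s u hu)
    linarith [this]
  | const x v =>
    refine ⟨1, Nat.size v, fun s s' hs' => ?_⟩
    rw [denote_const, PMF.mem_support_pure_iff] at hs'
    subst hs'
    simpa using sum_size_update_le V s x v
  | add x y z =>
    -- The old total, plus two operands each no longer than the total, plus one carry bit.
    refine ⟨3, 1, fun s s' hs' => ?_⟩
    rw [denote_add, PMF.mem_support_pure_iff] at hs'
    subst hs'
    have := sum_size_update_le V s x (s y + s z)
    have := size_add_le (s y) (s z)
    have := hmem s y (hV (by simp [Cmd.vars]))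
    have := hmem s z (hV (by simp [Cmd.vars]))
    omega
  | sub x y z =>
    refine ⟨2, 0, fun s s' hs' => ?_⟩
    rw [denote_sub, PMF.mem_support_pure_iff] at hs'
    subst hs'
    have := sum_size_update_le V s x (s y - s z)
    have := Nat.size_le_size (Nat.sub_le (s y) (s z))
    have := hmem s y (hV (by simp [Cmd.vars]))
    omega
  | div x y z =>
    refine ⟨2, 0, fun s s' hs' => ?_⟩
    rw [denote_div, PMF.mem_support_pure_iff] at hs'
    subst hs'
    have := sum_size_update_le V s x (s y / s z)
    have := Nat.size_le_size (Nat.div_le_self (s y) (s z))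
    have := hmem s y (hV (by simp [Cmd.vars]))
    omega
  | mulMod x y z w =>
    refine ⟨2, 0, fun s s' hs' => ?_⟩
    rw [denote_mulMod, PMF.mem_support_pure_iff] at hs'
    subst hs'
    have := sum_size_update_le V s x (if s w = 0 then 0 else (s y * s z) % s w)
    have := Nat.size_le_size (ite_mod_le (s y * s z) (s w))
    have := hmem s w (hV (by simp [Cmd.vars]))
    omega
  | powMod x y z w =>
    refine ⟨2, 0, fun s s' hs' => ?_⟩
    rw [denote_powMod, PMF.mem_support_pure_iff] at hs'
    subst hs'
    have := sum_size_update_le V s x (if s w = 0 then 0 else (s y ^ s z) % s w)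
    have := Nat.size_le_size (ite_mod_le (s y ^ s z) (s w))
    have := hmem s w (hV (by simp [Cmd.vars]))
    omega
  | rand x y =>
    refine ⟨2, 0, fun s s' hs' => ?_⟩
    rw [denote_rand, PMF.mem_support_map_iff] at hs'
    obtain ⟨v, -, rfl⟩ := hs'
    have := sum_size_update_le V s x v.val
    have := Nat.size_le_size (Nat.lt_succ_iff.1 v.2)
    have := hmem s y (hV (by simp [Cmd.vars]))
    omega

theorem eval_mono (P : Polynomial ℕ) {a b : ℕ} (h : a ≤ b) : P.eval a ≤ P.eval b := by
  rw [Polynomial.eval_eq_sum, Polynomial.eval_eq_sum]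
  exact Finset.sum_le_sum fun i _ => Nat.mul_le_mul_left _ (Nat.pow_le_pow_left h i)

theorem Straight.exists_ppt {c : Cmd} (hc : Straight c) :
    ∃ A : PPT, ∀ s, A.run s = denote c s := by
  have h : ∀ s, PPUFS.steps (cost c) ([c], s) = (denote c s).map fun s' => ([], s') :=
    fun s => hc.steps [] s 0
  refine ⟨⟨c, Polynomial.C (cost c), fun s C hC => ?_⟩, fun s => ?_⟩
  · rw [Polynomial.eval_C, h, PMF.mem_support_map_iff] at hC
    obtain ⟨_, -, rfl⟩ := hC
    rfl
  · rw [PPT.run, Polynomial.eval_C, h, PMF.map_comp]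
    exact PMF.map_id _

/-- A straight-line program followed by a polynomial-time program runs in polynomial time. -/
theorem Straight.exists_ppt_seq {c : Cmd} (hc : Straight c) (D : PPT) :
    ∃ A : PPT, ∀ s, A.run s = (denote c s).bind D.run := by
  -- The length is measured on the registers of both programs, since `D` may read registers that `c`
  -- does not mention.
  obtain ⟨a, b, hab⟩ := hc.size_le (V := (Cmd.seq c D.prog).vars)
    (by simp [Cmd.vars, Finset.subset_union_left])
  set time : Polynomial ℕ := Polynomial.C (cost c + 1) +
    D.time.comp (Polynomial.C a * Polynomial.X + Polynomial.C b) with htime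
  -- A budget for `D` that is the same for all outcomes of the coins of `c`; the actual bound of `D`
  -- varies with the intermediate state.
  set bd : State → ℕ := fun s =>
    D.time.eval (a * inputSize (.seq c D.prog) s + b) with hbd
  have heval : ∀ s, time.eval (inputSize (.seq c D.prog) s) = cost c + bd s + 1 := by
    intro s
    simp only [htime, hbd, Polynomial.eval_add, Polynomial.eval_C, Polynomial.eval_comp,
      Polynomial.eval_mul, Polynomial.eval_X]
    ring
  have hle : ∀ s, ∀ s' ∈ (denote c s).support, D.time.eval (inputSize D.prog s') ≤ bd s := by
    intro s s' hs'
    refine eval_mono _ (le_trans ?_ (hab s s' hs'))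
    exact Finset.sum_le_sum_of_subset (by simp [Cmd.vars, Finset.subset_union_right])
  have hsteps : ∀ s, PPUFS.steps (cost c + bd s + 1) ([.seq c D.prog], s) =
      (denote c s).bind fun s' => PPUFS.steps (bd s) ([D.prog], s') := by
    intro s
    rw [steps_succ, step, PMF.pure_bind, hc.steps]
  refine ⟨⟨.seq c D.prog, time, fun s C hC => ?_⟩, fun s => ?_⟩
  · rw [heval, hsteps, PMF.mem_support_bind_iff] at hC
    obtain ⟨s', hs', hC⟩ := hC
    rw [steps_of_le (hle s s' hs') (D.halts s')] at hC
    exact D.halts s' C hC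
  · rw [PPT.run, heval, hsteps, PMF.map_bind]
    ext u
    simp only [PMF.bind_apply]
    refine tsum_congr fun s' => ?_
    by_cases h0 : s' ∈ (denote c s).support
    · rw [steps_of_le (hle s s' h0) (D.halts s')]
      rfl
    · rw [PMF.apply_eq_zero_iff _ _ |>.2 h0, zero_mul, zero_mul]

/-! ## Arithmetic functions and their compilation -/

/-- Numerical functions of the variables `α` that are given by a term in the operations of the
machine. -/
inductive Arith {α : Type} : ((α → ℕ) → ℕ) → Prop
  | const (v : ℕ) : Arith fun _ => v
  | var (a : α) : Arith fun ρ => ρ a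
  | add {f g : (α → ℕ) → ℕ} : Arith f → Arith g → Arith fun ρ => f ρ + g ρ
  | sub {f g : (α → ℕ) → ℕ} : Arith f → Arith g → Arith fun ρ => f ρ - g ρ
  | div {f g : (α → ℕ) → ℕ} : Arith f → Arith g → Arith fun ρ => f ρ / g ρ
  | mulMod {f g h : (α → ℕ) → ℕ} : Arith f → Arith g → Arith h →
      Arith fun ρ => if h ρ = 0 then 0 else (f ρ * g ρ) % h ρ
  | powMod {f g h : (α → ℕ) → ℕ} : Arith f → Arith g → Arith h →
      Arith fun ρ => if h ρ = 0 then 0 else (f ρ ^ g ρ) % h ρ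

theorem Arith.subst {α β : Type} {f : (α → ℕ) → ℕ} (hf : Arith f) {σ : α → (β → ℕ) → ℕ}
    (hσ : ∀ a, Arith (σ a)) : Arith fun ρ => f fun a => σ a ρ := by
  induction hf with
  | const v => exact .const v
  | var a => exact hσ a
  | add _ _ h₁ h₂ => exact .add h₁ h₂
  | sub _ _ h₁ h₂ => exact .sub h₁ h₂
  | div _ _ h₁ h₂ => exact .div h₁ h₂
  | mulMod _ _ _ h₁ h₂ h₃ => exact .mulMod h₁ h₂ h₃
  | powMod _ _ _ h₁ h₂ h₃ => exact .powMod h₁ h₂ h₃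

theorem Arith.sum {α ι : Type} (s : Finset ι) {f : ι → (α → ℕ) → ℕ} (hf : ∀ i, Arith (f i)) :
    Arith fun ρ => ∑ i ∈ s, f i ρ := by
  classical
  induction s using Finset.induction_on with
  | empty => simpa using Arith.const 0
  | insert i s hi ih => simpa [Finset.sum_insert hi] using Arith.add (hf i) ih

/-- Lists of fixed length of arithmetic functions. -/
def ArithList {α : Type} (F : (α → ℕ) → List ℕ) : Prop :=
  ∃ fs : List ((α → ℕ) → ℕ), (∀ f ∈ fs, Arith f) ∧ ∀ ρ, F ρ = fs.map fun f => f ρ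

namespace ArithList

variable {α β : Type} {F G : (α → ℕ) → List ℕ}

theorem nil : ArithList fun _ : α → ℕ => ([] : List ℕ) := ⟨[], by simp, by simp⟩

theorem cons {f : (α → ℕ) → ℕ} (hf : Arith f) (hF : ArithList F) :
    ArithList fun ρ => f ρ :: F ρ := by
  obtain ⟨fs, h, hfs⟩ := hF
  exact ⟨f :: fs, by simpa [hf] using h, by simp [hfs]⟩

theorem append (hF : ArithList F) (hG : ArithList G) : ArithList fun ρ => F ρ ++ G ρ := by
  obtain ⟨fs, h, hfs⟩ := hF
  obtain ⟨gs, h', hgs⟩ := hG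
  refine ⟨fs ++ gs, fun f hf => ?_, by simp [hfs, hgs]⟩
  rcases List.mem_append.1 hf with hf | hf
  exacts [h f hf, h' f hf]

theorem ofFn {n : ℕ} {f : Fin n → (α → ℕ) → ℕ} (hf : ∀ i, Arith (f i)) :
    ArithList fun ρ => List.ofFn fun i => f i ρ := by
  refine ⟨List.ofFn f, fun g hg => ?_, fun ρ => by simp [List.map_ofFn, Function.comp_def]⟩
  obtain ⟨i, rfl⟩ := (List.mem_ofFn' _ _).1 hg
  exact hf i

theorem flatten {n : ℕ} {f : Fin n → (α → ℕ) → List ℕ} (hf : ∀ i, ArithList (f i)) :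
    ArithList fun ρ => (List.ofFn fun i => f i ρ).flatten := by
  induction n with
  | zero => simpa using nil
  | succ n ih =>
    simp only [List.ofFn_succ, List.flatten_cons]
    exact (hf 0).append (ih fun i => hf i.succ)

theorem table {n m : ℕ} {f : Fin n → Fin m → (α → ℕ) → ℕ} (hf : ∀ i j, Arith (f i j)) :
    ArithList fun ρ => tableList fun i j => f i j ρ :=
  flatten fun i => ofFn fun j => hf i j

theorem subst (hF : ArithList F) {σ : α → (β → ℕ) → ℕ} (hσ : ∀ a, Arith (σ a)) :
    ArithList fun ρ => F fun a => σ a ρ := by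
  obtain ⟨fs, h, hfs⟩ := hF
  refine ⟨fs.map fun f ρ => f fun a => σ a ρ, fun f hf => ?_, fun ρ => ?_⟩
  · obtain ⟨g, hg, rfl⟩ := List.mem_map.1 hf
    exact (h g hg).subst hσ
  · simp [hfs, Function.comp_def]

end ArithList

/-- `f` depends on the registers below `B` only, and can be computed into each register `t ≥ B`
without changing the registers below `t`, nor those above some bound. -/
def Computable (f : State → ℕ) (B : ℕ) : Prop :=
  (∀ s s' : State, (∀ x < B, s x = s' x) → f s = f s') ∧
  ∀ t, B ≤ t → ∃ c M, Straight c ∧ ∀ s, ∃ s', denote c s = PMF.pure s' ∧ s' t = f s ∧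
    (∀ x < t, s' x = s x) ∧ ∀ x, M ≤ x → s' x = s x

theorem Computable.mono {f : State → ℕ} {B B' : ℕ} (hf : Computable f B) (h : B ≤ B') :
    Computable f B' :=
  ⟨fun s s' hs => hf.1 s s' fun x hx => hs x (by omega), fun t ht => hf.2 t (h.trans ht)⟩

/-- The operands go into `t`, `t + 1`, `t + 2` in this order: each computation preserves all lower
registers, hence the inputs and the operands already found. Binary operations ignore the third
operand. -/
theorem Computable.ternary {f g h : State → ℕ} {B₁ B₂ B₃ : ℕ} (hf : Computable f B₁)
    (hg : Computable g B₂) (hh : Computable h B₃) (op : ℕ → ℕ → ℕ → ℕ)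
    (I : ℕ → ℕ → ℕ → ℕ → Cmd) (hI : ∀ x y z w, Straight (I x y z w))
    (hop : ∀ x y z w s,
      denote (I x y z w) s = PMF.pure (Function.update s x (op (s y) (s z) (s w)))) :
    ∃ B, Computable (fun s => op (f s) (g s) (h s)) B := by
  set B := max B₁ (max B₂ B₃)
  replace hf := hf.mono (B' := B) (by omega)
  replace hg := hg.mono (B' := B) (by omega)
  replace hh := hh.mono (B' := B) (by omega)
  refine ⟨B, fun s s' hs => by simp only [hf.1 s s' hs, hg.1 s s' hs, hh.1 s s' hs], fun t ht => ?_⟩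
  obtain ⟨c₁, M₁, hc₁, h₁⟩ := hf.2 t ht
  obtain ⟨c₂, M₂, hc₂, h₂⟩ := hg.2 (t + 1) (by omega)
  obtain ⟨c₃, M₃, hc₃, h₃⟩ := hh.2 (t + 2) (by omega)
  refine ⟨.seq c₁ (.seq c₂ (.seq c₃ (I t t (t + 1) (t + 2)))), max M₁ (max M₂ (max M₃ (t + 1))),
    .seq hc₁ (.seq hc₂ (.seq hc₃ (hI _ _ _ _))), fun s => ?_⟩
  obtain ⟨s₁, e₁, v₁, l₁, u₁⟩ := h₁ s
  obtain ⟨s₂, e₂, v₂, l₂, u₂⟩ := h₂ s₁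
  obtain ⟨s₃, e₃, v₃, l₃, u₃⟩ := h₃ s₂
  refine ⟨Function.update s₃ t (op (s₃ t) (s₃ (t + 1)) (s₃ (t + 2))), ?_, ?_, ?_, ?_⟩
  · simp only [denote_seq, e₁, e₂, e₃, PMF.pure_bind, hop]
  · have hg' : g s₁ = g s := hg.1 _ _ fun x hx => l₁ x (by omega)
    have hh' : h s₂ = h s := hh.1 _ _ fun x hx => by rw [l₂ x (by omega), l₁ x (by omega)]
    rw [Function.update_self, v₃, hh', l₃ (t + 1) (by omega), v₂, hg', l₃ t (by omega),
      l₂ t (by omega), v₁]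
  · intro x hx
    rw [Function.update_of_ne (by omega), l₃ x (by omega), l₂ x (by omega), l₁ x hx]
  · intro x hx
    rw [Function.update_of_ne (by omega), u₃ x (by omega), u₂ x (by omega), u₁ x (by omega)]

theorem Arith.computable {f : State → ℕ} (hf : Arith f) : ∃ B, Computable f B := by
  induction hf with
  | const v =>
    refine ⟨0, fun _ _ _ => rfl, fun t _ => ⟨.const t v, t + 1, .const _ _, fun s =>
      ⟨_, denote_const t v s, by simp, fun x hx => ?_, fun x hx => ?_⟩⟩⟩ <;>
    exact Function.update_of_ne (by omega) _ _
  | var a =>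
    -- Copying is done by clearing the target and adding; the bound `a + 1` ensures that the source
    -- is not the cleared register.
    refine ⟨a + 1, fun _ _ h => h a (by omega), fun t ht =>
      ⟨.seq (.const t 0) (.add t t a), t + 1, .seq (.const _ _) (.add _ _ _), fun s =>
      ⟨Function.update (Function.update s t 0) t
        (Function.update s t 0 t + Function.update s t 0 a), ?_, ?_, fun x hx => ?_,
        fun x hx => ?_⟩⟩⟩
    · rw [denote_seq, denote_const, PMF.pure_bind, denote_add]
    · simp [Function.update_of_ne (show a ≠ t by omega)]
    all_goals rw [Function.update_of_ne (by omega), Function.update_of_ne (by omega)]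
  | add _ _ h₁ h₂ =>
    obtain ⟨B₁, h₁⟩ := h₁
    obtain ⟨B₂, h₂⟩ := h₂
    exact h₁.ternary h₂ h₂ (fun a b _ => a + b) (fun x y z _ => .add x y z)
      (fun _ _ _ _ => .add _ _ _) fun _ _ _ _ => denote_add _ _ _
  | sub _ _ h₁ h₂ =>
    obtain ⟨B₁, h₁⟩ := h₁
    obtain ⟨B₂, h₂⟩ := h₂
    exact h₁.ternary h₂ h₂ (fun a b _ => a - b) (fun x y z _ => .sub x y z)
      (fun _ _ _ _ => .sub _ _ _) fun _ _ _ _ => denote_sub _ _ _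
  | div _ _ h₁ h₂ =>
    obtain ⟨B₁, h₁⟩ := h₁
    obtain ⟨B₂, h₂⟩ := h₂
    exact h₁.ternary h₂ h₂ (fun a b _ => a / b) (fun x y z _ => .div x y z)
      (fun _ _ _ _ => .div _ _ _) fun _ _ _ _ => denote_div _ _ _
  | mulMod _ _ _ h₁ h₂ h₃ =>
    obtain ⟨B₁, h₁⟩ := h₁
    obtain ⟨B₂, h₂⟩ := h₂
    obtain ⟨B₃, h₃⟩ := h₃
    exact h₁.ternary h₂ h₃ (fun a b c => if c = 0 then 0 else (a * b) % c) .mulMod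
      .mulMod denote_mulMod
  | powMod _ _ _ h₁ h₂ h₃ =>
    obtain ⟨B₁, h₁⟩ := h₁
    obtain ⟨B₂, h₂⟩ := h₂
    obtain ⟨B₃, h₃⟩ := h₃
    exact h₁.ternary h₂ h₃ (fun a b c => if c = 0 then 0 else (a ^ b) % c) .powMod
      .powMod denote_powMod

theorem exists_common_bound {fs : List (State → ℕ)} (hfs : ∀ f ∈ fs, Arith f) :
    ∃ B, ∀ f ∈ fs, Computable f B := by
  induction fs with
  | nil => exact ⟨0, by simp⟩
  | cons f fs ih =>
    obtain ⟨B, hB⟩ := ih fun g hg => hfs g (by simp [hg])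
    obtain ⟨B', hB'⟩ := (hfs f (by simp)).computable
    refine ⟨max B B', fun g hg => ?_⟩
    rcases List.mem_cons.1 hg with rfl | hg
    · exact hB'.mono (le_max_right _ _)
    · exact (hB g hg).mono (le_max_left _ _)

/-- A list of functions can be evaluated into a block of registers. -/
theorem exists_block {B : ℕ} {fs : List (State → ℕ)} (hfs : ∀ f ∈ fs, Computable f B) (t : ℕ)
    (ht : B ≤ t) : ∃ c M, Straight c ∧ ∀ s, ∃ s', denote c s = PMF.pure s' ∧
      (∀ i, i < fs.length → s' (t + i) = (fs.map fun f => f s).getD i 0) ∧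
      (∀ x < t, s' x = s x) ∧ ∀ x, M ≤ x → s' x = s x := by
  induction fs generalizing t with
  | nil =>
    refine ⟨.const t 0, t + 1, .const _ _, fun s => ⟨_, denote_const t 0 s, by simp,
      fun x hx => ?_, fun x hx => ?_⟩⟩ <;>
    exact Function.update_of_ne (by omega) _ _
  | cons f fs ih =>
    obtain ⟨c₁, M₁, hc₁, h₁⟩ := (hfs f (by simp)).2 t ht
    obtain ⟨c₂, M₂, hc₂, h₂⟩ := ih (fun g hg => hfs g (by simp [hg])) (t + 1) (by omega)
    refine ⟨.seq c₁ c₂, max M₁ M₂, .seq hc₁ hc₂, fun s => ?_⟩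
    obtain ⟨s₁, e₁, v₁, l₁, u₁⟩ := h₁ s
    obtain ⟨s₂, e₂, v₂, l₂, u₂⟩ := h₂ s₁
    refine ⟨s₂, by rw [denote_seq, e₁, PMF.pure_bind, e₂], fun i hi => ?_, fun x hx => ?_,
      fun x hx => ?_⟩
    · rcases i with _ | i
      · simpa [v₁] using l₂ t (by omega)
      · have : (fs.map fun f => f s₁) = fs.map fun f => f s :=
          List.map_congr_left fun g hg =>
            (hfs g (by simp [hg])).1 _ _ fun x hx => l₁ x (by omega)
        rw [show t + (i + 1) = t + 1 + i by ring, v₂ i (by simpa using hi), this]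
        simp
    · rw [l₂ x (by omega), l₁ x hx]
    · rw [u₂ x (by omega), u₁ x (by omega)]

/-- Register `u` is a zero kept outside both blocks, so that adding it copies; `hL` keeps the blocks
disjoint. -/
theorem exists_copy (t u L : ℕ) (hL : L ≤ t) (hu : t + L ≤ u) : ∃ c, Straight c ∧ ∀ s,
    denote c s = PMF.pure fun x => if x < L then s (t + x) else if x = u then 0 else s x := by
  induction L with
  | zero =>
    refine ⟨.const u 0, .const _ _, fun s => ?_⟩
    rw [denote_const]
    congr 1
    funext x
    by_cases hx : x = u <;> simp [hx]
  | succ L ih =>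
    obtain ⟨c, hc, h⟩ := ih (by omega) (by omega)
    refine ⟨.seq c (.add L u (t + L)), .seq hc (.add _ _ _), fun s => ?_⟩
    rw [denote_seq, h, PMF.pure_bind, denote_add]
    congr 1
    funext x
    have h₁ : ¬ u < L := by omega
    have h₂ : ¬ t + L < L := by omega
    have h₃ : t + L ≠ u := by omega
    by_cases hx : x = L
    · subst hx
      simp [h₁, h₃]
    · have : x < L + 1 ↔ x < L := by omega
      simp [hx, this]

/-- Used to erase the workspace: a program that runs afterwards may read any register, so the final
state must be exactly a loaded list. -/
theorem exists_clear (L d : ℕ) : ∃ c, Straight c ∧ ∀ s,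
    denote c s = PMF.pure fun x => if L ≤ x ∧ x ≤ L + d then 0 else s x := by
  induction d with
  | zero =>
    refine ⟨.const L 0, .const _ _, fun s => ?_⟩
    rw [denote_const]
    congr 1
    funext x
    by_cases hx : x = L
    · simp [hx]
    · have : ¬ (L ≤ x ∧ x ≤ L + 0) := by omega
      simp only [this, if_false, Function.update_of_ne hx]
  | succ d ih =>
    obtain ⟨c, hc, h⟩ := ih
    refine ⟨.seq c (.const (L + (d + 1)) 0), .seq hc (.const _ _), fun s => ?_⟩
    rw [denote_seq, h, PMF.pure_bind, denote_const]
    congr 1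
    funext x
    by_cases hx : x = L + (d + 1)
    · simp [hx]
    · have : (L ≤ x ∧ x ≤ L + (d + 1)) ↔ (L ≤ x ∧ x ≤ L + d) := by omega
      simp only [this, Function.update_of_ne hx]

/-- Every list of arithmetic functions of the registers is computed by a straight-line program
that leaves nothing else in the registers. -/
theorem ArithList.exists_program {F : State → List ℕ} (hF : ArithList F) (B : ℕ) :
    ∃ c, Straight c ∧ ∀ s : State, (∀ x, B ≤ x → s x = 0) →
      denote c s = PMF.pure (load (F s)) := by
  obtain ⟨fs, hfs, hF⟩ := hF
  obtain ⟨B', hB'⟩ := exists_common_bound hfs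
  -- The block lies above the inputs and above the place to which it is copied back. Registers
  -- beyond the cleared range are above `M` and `B`, hence were zero from the start.
  set t := max B (max B' fs.length) with ht
  obtain ⟨c₁, M, hc₁, h₁⟩ := exists_block hB' t (by omega)
  set u := max M (t + fs.length) with hu
  obtain ⟨c₂, hc₂, h₂⟩ := exists_copy t u fs.length (by omega) (by omega)
  obtain ⟨c₃, hc₃, h₃⟩ := exists_clear fs.length u
  refine ⟨.seq c₁ (.seq c₂ c₃), .seq hc₁ (.seq hc₂ hc₃), fun s hs => ?_⟩
  obtain ⟨s₁, e₁, v₁, -, u₁⟩ := h₁ s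
  rw [denote_seq, e₁, PMF.pure_bind, denote_seq, h₂, PMF.pure_bind, h₃, hF]
  congr 1
  funext x
  by_cases hx : x < fs.length
  · have : ¬ fs.length ≤ x := by omega
    simp only [this, hx, false_and, if_true, if_false, v₁ x hx, load]
  · rw [load, List.getD_eq_default _ _ (by simpa using hx)]
    by_cases hx' : x ≤ fs.length + u
    · simp [hx', not_lt.1 hx]
    · have hxu : x ≠ u := by omega
      simp only [hx', hx, hxu, and_false, if_false]
      rw [u₁ x (by omega), hs x (by omega)]

/-! ## Uniform distributions and sampling programs -/

theorem map_uniform_equiv {A B : Type} [Fintype A] [Nonempty A] [Fintype B] [Nonempty B]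
    (e : A ≃ B) : (PMF.uniformOfFintype A).map e = PMF.uniformOfFintype B := by
  ext b
  rw [PMF.map_apply, PMF.uniformOfFintype_apply, tsum_eq_single (e.symm b)]
  · simp [Fintype.card_congr e]
  · intro a ha
    rw [if_neg]
    rintro rfl
    simp at ha

theorem uniform_prod {A B : Type} [Fintype A] [Nonempty A] [Fintype B] [Nonempty B] :
    PMF.uniformOfFintype (A × B) =
      (PMF.uniformOfFintype A).bind fun a => (PMF.uniformOfFintype B).map fun b => (a, b) := by
  ext ⟨a, b⟩
  rw [PMF.bind_apply, tsum_eq_single a, PMF.map_apply, tsum_eq_single b]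
  · simp only [PMF.uniformOfFintype_apply, Fintype.card_prod, if_true, Nat.cast_mul]
    rw [ENNReal.mul_inv] <;> simp
  · intro b' hb
    rw [if_neg]
    rintro h
    exact hb (Prod.ext_iff.1 h).2.symm
  · intro a' ha
    rw [PMF.map_apply, ENNReal.tsum_eq_zero.2, mul_zero]
    intro b'
    rw [if_neg]
    rintro h
    exact ha (Prod.ext_iff.1 h).1.symm

/-- The range of `rand` includes its bound, so residues mod `n` are drawn from a register holding `n
- 1`. -/
theorem denote_rand_eq {x y : ℕ} {s : State} {n : ℕ} [NeZero n] (h : s y + 1 = n) :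
    denote (.rand x y) s =
      (PMF.uniformOfFintype (ZMod n)).map fun v => Function.update s x v.val := by
  subst h
  rw [denote_rand]
  rfl

theorem load_append (l : List ℕ) (v : ℕ) :
    Function.update (load l) l.length v = load (l ++ [v]) := by
  funext x
  simp only [load, Function.update_apply]
  split
  · next h => subst h; simp
  · next h =>
    rcases lt_or_gt_of_ne h with h | h
    · rw [List.getD_append _ _ _ _ h]
    · rw [List.getD_eq_default _ _ h.le, List.getD_eq_default]
      simp only [List.length_append, List.length_singleton]
      omega

theorem load_append_of_lt {l l' : List ℕ} {x : ℕ} (h : x < l.length) :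
    load (l ++ l') x = load l x := List.getD_append _ _ _ _ h

theorem load_eq_zero {l : List ℕ} {x : ℕ} (h : l.length ≤ x) : load l x = 0 :=
  List.getD_eq_default _ _ h

/-- Sampling a sequence of residues. -/
theorem exists_sampler (a y T : ℕ) (hy : y < a) : ∃ c, Straight c ∧
    ∀ (l : List ℕ) (n : ℕ) [NeZero n], l.length = a → load l y + 1 = n →
      denote c (load l) = (PMF.uniformOfFintype (Fin T → ZMod n)).map fun v =>
        load (l ++ List.ofFn fun i => (v i).val) := by
  induction T generalizing a with
  | zero =>
    refine ⟨.const a 0, .const _ _, fun l n _ hl hn => ?_⟩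
    have : Function.update (load l) a 0 = load l := by
      rw [← load_eq_zero hl.le, Function.update_eq_self]
    rw [denote_const, this]
    simp [Function.const_def, PMF.map_const]
  | succ T ih =>
    obtain ⟨c, hc, h⟩ := ih (a + 1) (by omega)
    refine ⟨.seq (.rand a y) c, .seq (.rand _ _) hc, fun l n _ hl hn => ?_⟩
    rw [denote_seq, denote_rand_eq hn, PMF.bind_map,
      ← map_uniform_equiv (Fin.consEquiv fun _ : Fin (T + 1) => ZMod n), PMF.map_comp,
      uniform_prod, PMF.map_bind]
    congr 1
    funext v
    subst hl
    simp only [Function.comp_apply, load_append]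
    rw [h (l ++ [v.val]) n (by simp) (by rw [load_append_of_lt hy, hn]), PMF.map_comp]
    congr 1
    funext w
    simp [Fin.consEquiv, List.ofFn_succ]

/-- Evaluation of arithmetic functions on the input and on uniformly random residues modulo a
number in the input. -/
theorem ArithList.exists_randomized {ι : Type} [Fintype ι] [DecidableEq ι]
    {F : (ℕ ⊕ ι → ℕ) → List ℕ}
    (hF : ArithList F) (a y : ℕ) (hy : y < a) : ∃ c, Straight c ∧
    ∀ (l : List ℕ) (n : ℕ) [NeZero n], l.length = a → load l y = n →
      denote c (load l) = (PMF.uniformOfFintype (ι → ZMod n)).map fun v =>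
        load (F (Sum.elim (load l) fun i => (v i).val)) := by
  set T := Fintype.card ι
  obtain ⟨e⟩ : Nonempty (ι ≃ Fin T) := ⟨Fintype.equivFin ι⟩
  obtain ⟨c₁, hc₁, h₁⟩ := exists_sampler (a + 1) a T (by omega)
  -- Register `a` will hold `n - 1` and the samples follow from `a + 1` on. Variables from `a` on
  -- must read as zero, as they do in the original input.
  set σ : ℕ ⊕ ι → State → ℕ :=
    Sum.elim (fun x s => if x < a then s x else 0) fun i s => s (a + 1 + e i) with hσ
  have hσ' : ∀ z, Arith (σ z) := by
    rintro (x | i)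
    · by_cases h : x < a
      · simpa [hσ, h] using Arith.var x
      · simpa [hσ, h] using Arith.const 0
    · exact Arith.var _
  obtain ⟨c₂, hc₂, h₂⟩ := (hF.subst hσ').exists_program (a + 1 + T)
  refine ⟨.seq (.seq (.const a 1) (.sub a y a)) (.seq c₁ c₂),
    .seq (.seq (.const _ _) (.sub _ _ _)) (.seq hc₁ hc₂), fun l n _ hl hn => ?_⟩
  have hn0 : 0 < n := Nat.pos_of_ne_zero (NeZero.ne n)
  rw [denote_seq, denote_seq, denote_const, PMF.pure_bind, denote_sub, PMF.pure_bind,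
    Function.update_self, Function.update_of_ne hy.ne, hn, Function.update_idem]
  subst hl
  rw [load_append, denote_seq,
    h₁ _ n (by simp) (by rw [← load_append, Function.update_self]; omega), PMF.bind_map,
    ← map_uniform_equiv (e.symm.arrowCongr (Equiv.refl (ZMod n))), PMF.map_comp,
    ← PMF.bind_pure_comp]
  congr 1
  funext v
  simp only [Function.comp_apply]
  rw [h₂ _ fun x hx => load_eq_zero (by simp; omega)]
  congr 3
  funext z
  rcases z with x | i
  · by_cases h : x < l.length
    · simp only [hσ, Sum.elim_inl, h, if_true]
      rw [load_append_of_lt (by simp; omega), load_append_of_lt h]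
    · simp only [hσ, Sum.elim_inl, h, if_false]
      rw [load_eq_zero (not_lt.1 h)]
  · simp only [hσ, Sum.elim_inr, load]
    rw [List.getD_append_right _ _ _ _ (by simp)]
    simp

/-! ## The Paillier cryptosystem -/

/-- The number that represents `(1 + n) ^ x * r ^ n` modulo `n₂`. -/
def encNat (n n₂ x r : ℕ) : ℕ :=
  if n₂ = 0 then 0 else
    (if n₂ = 0 then 0 else (1 + n) ^ x % n₂) * (if n₂ = 0 then 0 else r ^ n % n₂) % n₂

/-- The number that represents `c * (1 + n) ^ x` modulo `n₂`. -/
def shiftNat (n n₂ c x : ℕ) : ℕ :=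
  if n₂ = 0 then 0 else c * (if n₂ = 0 then 0 else (1 + n) ^ x % n₂) % n₂

/-- The residue of `x` modulo `n`. -/
def modNat (x n : ℕ) : ℕ := if n = 0 then 0 else x * 1 % n

namespace Arith

variable {α : Type} {f g h i : (α → ℕ) → ℕ}

theorem encNat (hf : Arith f) (hg : Arith g) (hh : Arith h) (hi : Arith i) :
    Arith fun ρ => encNat (f ρ) (g ρ) (h ρ) (i ρ) :=
  .mulMod (.powMod (.add (.const 1) hf) hh hg) (.powMod hi hf hg) hg

theorem shiftNat (hf : Arith f) (hg : Arith g) (hh : Arith h) (hi : Arith i) :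
    Arith fun ρ => shiftNat (f ρ) (g ρ) (h ρ) (i ρ) :=
  .mulMod hh (.powMod (.add (.const 1) hf) hi hg) hg

theorem modNat (hf : Arith f) (hg : Arith g) : Arith fun ρ => modNat (f ρ) (g ρ) :=
  .mulMod hf (.const 1) hg

/-- The machine multiplies only modulo a register, so a fixed factor is repeated addition. -/
theorem const_mul (v : ℕ) (hf : Arith f) : Arith fun ρ => v * f ρ := by
  induction v with
  | zero => simpa using Arith.const 0
  | succ v ih => simpa [Nat.succ_mul] using ih.add hf

end Arith

namespace KeyPair

variable {k : ℕ} (K : KeyPair k)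

theorem prime_p : K.p.Prime := K.2.1
theorem prime_q : K.q.Prime := K.2.2.1

theorem p_ne_q : K.p ≠ K.q := K.2.2.2.1
theorem size_p : K.p.size = k := K.2.2.2.2.1
theorem size_q : K.q.size = k := K.2.2.2.2.2.1

theorem coprime_totient : Nat.Coprime K.n ((K.p - 1) * (K.q - 1)) := K.2.2.2.2.2.2

theorem n_pos : 0 < K.n := Nat.pos_of_ne_zero (NeZero.ne _)

theorem n_sq_ne_zero : K.n ^ 2 ≠ 0 := pow_ne_zero _ (NeZero.ne _)

theorem totient_n : K.n.totient = (K.p - 1) * (K.q - 1) := by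
  rw [n, Nat.totient_mul ((Nat.coprime_primes K.prime_p K.prime_q).2 K.p_ne_q),
    Nat.totient_prime K.prime_p, Nat.totient_prime K.prime_q]

theorem pow_le_p : 2 ^ (k - 1) ≤ K.p := by
  have h := K.size_p
  have hp : 0 < K.p.size := Nat.size_pos.2 K.prime_p.pos
  exact Nat.lt_size.1 (by omega)

theorem pow_le_q : 2 ^ (k - 1) ≤ K.q := by
  have h := K.size_q
  have hp : 0 < K.q.size := Nat.size_pos.2 K.prime_q.pos
  exact Nat.lt_size.1 (by omega)

theorem n_sq_cast : (K.n : K.Cipher) * K.n = 0 := by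
  rw [← Nat.cast_mul, ← pow_two, ZMod.natCast_self]

/-- The binomial expansion stops after the linear term, because n² = 0. Consequently only the
exponent mod n matters. -/
theorem one_add_n_pow (x : ℕ) : (1 + (K.n : K.Cipher)) ^ x = 1 + x * K.n := by
  induction x with
  | zero => simp
  | succ x ih =>
    rw [pow_succ, ih]
    push_cast
    linear_combination (x : K.Cipher) * K.n_sq_cast

theorem cast_mul_n_eq {x y : ℕ} (h : x ≡ y [MOD K.n]) :
    (x : K.Cipher) * K.n = (y : K.Cipher) * K.n := by
  rw [← Nat.cast_mul, ← Nat.cast_mul, ZMod.natCast_eq_natCast_iff, pow_two]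
  exact h.mul_right' _

theorem one_add_n_pow_congr {x y : ℕ} (h : x ≡ y [MOD K.n]) :
    (1 + (K.n : K.Cipher)) ^ x = (1 + (K.n : K.Cipher)) ^ y := by
  rw [one_add_n_pow, one_add_n_pow, K.cast_mul_n_eq h]

/-- If n divides a - b, then n² divides a^n - b^n. So the choice of representative of a nonce does
not affect the ciphertext. -/
theorem cast_pow_n_congr {a b : ℕ} (h : a ≡ b [MOD K.n]) :
    (a : K.Cipher) ^ K.n = (b : K.Cipher) ^ K.n := by
  have h' : ((K.n : ℤ)) ∣ a - b := by
    have := (Nat.modEq_iff_dvd.1 h.symm)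
    exact this
  have := dvd_sub_pow_of_dvd_sub h' 1
  rw [← Nat.cast_pow, ← Nat.cast_pow, ZMod.natCast_eq_natCast_iff]
  refine (Nat.modEq_iff_dvd.2 ?_).symm
  push_cast
  simpa using this

theorem natCast_val_modEq (x : ℕ) : ((x : ZMod K.n)).val ≡ x [MOD K.n] := by
  rw [ZMod.val_natCast]
  exact Nat.mod_modEq _ _

theorem modEq_iff {x y : ℕ} : x ≡ y [MOD K.n] ↔ (x : ZMod K.n) = y :=
  (ZMod.natCast_eq_natCast_iff _ _ _).symm

theorem enc_mul (x y : K.Plain) (r s : K.Nonce) :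
    K.enc x r * K.enc y s = K.enc (x + y) (r * s) := by
  have h₁ : (1 + (K.n : K.Cipher)) ^ (x + y).val = (1 + (K.n : K.Cipher)) ^ (x.val + y.val) :=
    K.one_add_n_pow_congr (K.modEq_iff.2 (by simp))
  have h₂ : (((r * s : K.Nonce) : ZMod K.n).val : K.Cipher) ^ K.n =
      (((r : ZMod K.n).val * (s : ZMod K.n).val : ℕ) : K.Cipher) ^ K.n :=
    K.cast_pow_n_congr (K.modEq_iff.2 (by simp))
  simp only [enc]
  rw [h₁, h₂, pow_add, Nat.cast_mul, mul_pow]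
  ring

theorem enc_zero_one : K.enc 0 1 = 1 := by
  have h : (((1 : K.Nonce) : ZMod K.n).val : K.Cipher) ^ K.n = ((1 : ℕ) : K.Cipher) ^ K.n :=
    K.cast_pow_n_congr (K.modEq_iff.2 (by simp))
  rw [enc, h]
  simp

theorem enc_pow (x : K.Plain) (r : K.Nonce) (t : ℕ) :
    K.enc x r ^ t = K.enc (t * x) (r ^ t) := by
  induction t with
  | zero => simp [enc_zero_one]
  | succ t ih =>
    rw [pow_succ, ih, enc_mul, pow_succ]
    congr 1
    push_cast
    ring

theorem enc_inv (x : K.Plain) (r : K.Nonce) : (K.enc x r)⁻¹ = K.enc (-x) r⁻¹ := by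
  have h : K.enc x r * K.enc (-x) r⁻¹ = 1 := by
    rw [enc_mul, add_neg_cancel, mul_inv_cancel, enc_zero_one]
  -- The inverse in `ZMod` is a total function, and it is a true inverse only at units.
  have hu : IsUnit (K.enc x r) := IsUnit.of_mul_eq_one _ h
  calc (K.enc x r)⁻¹ = (K.enc x r)⁻¹ * (K.enc x r * K.enc (-x) r⁻¹) := by rw [h, mul_one]
    _ = K.enc (-x) r⁻¹ := by rw [← mul_assoc, ZMod.inv_mul_of_unit _ hu, one_mul]

theorem enc_prod {ι : Type} (s : Finset ι) (x : ι → K.Plain) (r : ι → K.Nonce) :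
    ∏ i ∈ s, K.enc (x i) (r i) = K.enc (∑ i ∈ s, x i) (∏ i ∈ s, r i) := by
  classical
  induction s using Finset.induction_on with
  | empty => simp [enc_zero_one]
  | insert i s hi ih => rw [Finset.prod_insert hi, Finset.sum_insert hi, Finset.prod_insert hi, ih,
      enc_mul]

/-- The exponent is φ(n), so Euler's theorem removes the nonce. -/
theorem enc_pow_totient (x : K.Plain) (r : K.Nonce) :
    K.enc x r ^ ((K.p - 1) * (K.q - 1)) =
      1 + ((x * (((K.p - 1) * (K.q - 1) : ℕ) : ZMod K.n)).val : K.Cipher) * K.n := by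
  have hr : r ^ ((K.p - 1) * (K.q - 1)) = 1 := by
    rw [← totient_n]
    exact ZMod.pow_totient r
  have h : (((1 : K.Nonce) : ZMod K.n).val : K.Cipher) ^ K.n = ((1 : ℕ) : K.Cipher) ^ K.n :=
    K.cast_pow_n_congr (K.modEq_iff.2 (by simp))
  rw [enc_pow, hr, enc, h, Nat.cast_one, one_pow, mul_one, one_add_n_pow, mul_comm x]

theorem dec_enc (x : K.Plain) (r : K.Nonce) : K.dec (K.enc x r) = x := by
  set t := (K.p - 1) * (K.q - 1) with ht
  set u := x * (t : ZMod K.n) with hu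
  -- No reduction mod n² takes place, so subtracting 1 and dividing by n is exact and returns `u`.
  -- The factor `t` is then cancelled using the gcd condition on the key.
  have hlt : 1 + u.val * K.n < K.n ^ 2 := by
    have h1 : u.val < K.n := ZMod.val_lt u
    have h2 : 2 ≤ K.n := by
      have := K.prime_p.two_le
      have := K.prime_q.two_le
      unfold n
      nlinarith
    nlinarith
  have hval : (K.enc x r ^ t).val = 1 + u.val * K.n := by
    rw [enc_pow_totient, ← ht, ← hu]
    have : (1 + (u.val : K.Cipher) * K.n) = ((1 + u.val * K.n : ℕ) : K.Cipher) := by push_cast; ring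
    rw [this, ZMod.val_natCast, Nat.mod_eq_of_lt hlt]
  have hunit : IsUnit (t : ZMod K.n) :=
    (ZMod.isUnit_iff_coprime _ _).2 K.coprime_totient.symm
  rw [dec, ← ht, hval, Nat.add_sub_cancel_left, Nat.mul_div_cancel _ K.n_pos, ZMod.natCast_zmod_val,
    hu, mul_assoc, ZMod.mul_inv_of_unit _ hunit, mul_one]

theorem enc_natCast_val (x : ℕ) (r : K.Nonce) :
    (K.enc (x : ZMod K.n) r).val = encNat K.n (K.n ^ 2) x (r : ZMod K.n).val := by
  have : K.enc (x : ZMod K.n) r = (((1 + K.n) ^ x * (r : ZMod K.n).val ^ K.n : ℕ) : K.Cipher) := by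
    rw [enc, K.one_add_n_pow_congr (K.natCast_val_modEq x)]
    push_cast
    rfl
  rw [this, ZMod.val_natCast]
  simp only [encNat, K.n_sq_ne_zero, if_false]
  exact Nat.mul_mod _ _ _

/-- A plaintext can be shifted with the public key alone and without changing the nonce. This is how
the second-stage masks enter the operator's view after the encryption of the shares. -/
theorem enc_add_natCast_val (x : K.Plain) (y : ℕ) (r : K.Nonce) :
    (K.enc (x + y) r).val = shiftNat K.n (K.n ^ 2) (K.enc x r).val y := by
  have : K.enc (x + y) r = (((K.enc x r).val * (1 + K.n) ^ y : ℕ) : K.Cipher) := by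
    have h₁ : (1 + (K.n : K.Cipher)) ^ (x + y).val = (1 + (K.n : K.Cipher)) ^ (x.val + y) :=
      K.one_add_n_pow_congr (K.modEq_iff.2 (by simp))
    rw [Nat.cast_mul, ZMod.natCast_zmod_val, enc, h₁, enc, pow_add]
    push_cast
    ring
  rw [this, ZMod.val_natCast]
  simp only [shiftNat, K.n_sq_ne_zero, if_false]
  rw [Nat.mul_mod, Nat.mul_mod (K.enc x r).val, Nat.mod_mod]

theorem natCast_val_eq_modNat (x : ℕ) : (x : ZMod K.n).val = modNat x K.n := by
  rw [ZMod.val_natCast, modNat, if_neg K.n_pos.ne', mul_one]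

end KeyPair

open scoped BigOperators
open Filter

/-! ## Averages, negligible functions and indistinguishability -/

theorem acceptProb_nonneg (μ : PMF State) : 0 ≤ acceptProb μ := ENNReal.toReal_nonneg

theorem acceptProb_le_one (μ : PMF State) : acceptProb μ ≤ 1 := by
  rw [acceptProb, ← ENNReal.toReal_one]
  exact ENNReal.toReal_mono ENNReal.one_ne_top (PMF.coe_le_one _ _)

theorem acceptProb_uniform_bind {A : Type} [Fintype A] [Nonempty A] (f : A → PMF State) :
    acceptProb ((PMF.uniformOfFintype A).bind f) = 𝔼 a, acceptProb (f a) := by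
  rw [acceptProb, PMF.map_bind, PMF.bind_apply, tsum_fintype, ENNReal.toReal_sum]
  · rw [Fintype.expect_eq_sum_div_card, Finset.sum_div]
    refine Finset.sum_congr rfl fun a _ => ?_
    rw [ENNReal.toReal_mul, PMF.uniformOfFintype_apply, ENNReal.toReal_inv, ENNReal.toReal_natCast,
      div_eq_inv_mul]
    rfl
  · intro a _
    exact ENNReal.mul_ne_top (PMF.apply_ne_top _ _) (PMF.apply_ne_top _ _)

theorem abs_expect_sub_le {A : Type} [Fintype A] [Nonempty A] {f g : A → ℝ} {ε : ℝ}
    (h : ∀ a, |f a - g a| ≤ ε) : |𝔼 a, f a - 𝔼 a, g a| ≤ ε := by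
  rw [← Finset.expect_sub_distrib]
  refine (Finset.abs_expect_le _ _).trans ?_
  exact Finset.expect_le Finset.univ_nonempty fun a _ => h a

/-- The average over a subset is close to the average over the whole set. -/
theorem abs_expect_comp_sub_le {A B : Type} [Fintype A] [Nonempty A] [Fintype B] {e : A → B}
    (he : Function.Injective e) {f : B → ℝ} (h₀ : ∀ b, 0 ≤ f b) (h₁ : ∀ b, f b ≤ 1) :
    |𝔼 a, f (e a) - 𝔼 b, f b| ≤ 1 - (Fintype.card A : ℝ) / Fintype.card B := by
  classical
  have hle : Fintype.card A ≤ Fintype.card B := Fintype.card_le_of_injective e he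
  have hA : (0 : ℝ) < Fintype.card A := by exact_mod_cast Fintype.card_pos
  have hB : (0 : ℝ) < Fintype.card B := by
    have := Fintype.card_pos (α := A)
    exact_mod_cast lt_of_lt_of_le this hle
  set S := ∑ a, f (e a) with hS
  have hS₀ : 0 ≤ S := Finset.sum_nonneg fun a _ => h₀ _
  have hS₁ : S ≤ Fintype.card A := by
    refine (Finset.sum_le_sum fun a _ => h₁ (e a)).trans ?_
    simp
  have hsplit : ∑ b, f b = S + ∑ b ∈ (Finset.univ.image e)ᶜ, f b := by
    rw [← Finset.sum_add_sum_compl (Finset.univ.image e), Finset.sum_image he.injOn]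
  have hR₀ : 0 ≤ ∑ b ∈ (Finset.univ.image e)ᶜ, f b := Finset.sum_nonneg fun a _ => h₀ _
  have hR₁ : ∑ b ∈ (Finset.univ.image e)ᶜ, f b ≤ (Fintype.card B : ℝ) - Fintype.card A := by
    refine (Finset.sum_le_sum fun a _ => h₁ a).trans ?_
    rw [Finset.sum_const, nsmul_eq_mul, mul_one, Finset.card_compl,
      Finset.card_image_of_injective _ he, Finset.card_univ, Nat.cast_sub hle]
  set R := ∑ b ∈ (Finset.univ.image e)ᶜ, f b
  rw [Fintype.expect_eq_sum_div_card, Fintype.expect_eq_sum_div_card, hsplit, ← hS]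
  have hle' : (Fintype.card A : ℝ) ≤ Fintype.card B := by exact_mod_cast hle
  generalize (Fintype.card A : ℝ) = a at *
  generalize (Fintype.card B : ℝ) = b at *
  have h1 : S / a ≤ 1 := (div_le_one hA).2 hS₁
  -- Both terms on the right lie between 0 and 1 - a / b, so their difference is bounded by this in
  -- absolute value.
  have h2 : S / a - (S + R) / b = S / a * (1 - a / b) - R / b := by field_simp; ring
  have h3 : 0 ≤ 1 - a / b := by
    rw [sub_nonneg]
    exact (div_le_one hB).2 hle'
  have h4 : R / b ≤ 1 - a / b := by
    rw [le_sub_iff_add_le, ← add_div, div_le_one hB]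
    linarith
  have h5 : 0 ≤ R / b := div_nonneg hR₀ hB.le
  have h6 : 0 ≤ S / a := div_nonneg hS₀ hA.le
  rw [h2, abs_le]
  constructor <;> nlinarith

theorem abs_keyAvg_sub_le {k : ℕ} {f g : KeyPair k → ℝ} {ε : ℝ} (hε : 0 ≤ ε)
    (h : ∀ K, |f K - g K| ≤ ε) : |keyAvg k f - keyAvg k g| ≤ ε := by
  rw [keyAvg, keyAvg, ← sub_div, ← Finset.sum_sub_distrib, abs_div, Nat.abs_cast]
  -- There may be no key pair for this `k`; then both averages are 0 / 0 = 0 and `hε` is what is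
  -- needed.
  refine div_le_of_le_mul₀ (Nat.cast_nonneg _) hε ?_
  refine (Finset.abs_sum_le_sum_abs _ _).trans ((Finset.sum_le_sum fun K _ => h K).trans ?_)
  rw [Finset.sum_const, nsmul_eq_mul, Finset.card_univ, mul_comm]

theorem Negligible.mono {f g : ℕ → ℝ} (hg : Negligible g) (h : ∀ᶠ k in atTop, |f k| ≤ g k) :
    Negligible f := by
  refine Asymptotics.SuperpolynomialDecay.trans_eventually_abs_le hg ?_
  filter_upwards [h] with k hk
  exact hk.trans (le_abs_self _)

theorem Negligible.add {f g : ℕ → ℝ} (hf : Negligible f) (hg : Negligible g) :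
    Negligible fun k => f k + g k := Asymptotics.SuperpolynomialDecay.add hf hg

theorem negligible_zero : Negligible fun _ => 0 :=
  Asymptotics.superpolynomialDecay_zero _ _

theorem Negligible.sum {ι : Type} (s : Finset ι) {f : ι → ℕ → ℝ} (hf : ∀ i, Negligible (f i)) :
    Negligible fun k => ∑ i ∈ s, f i k := by
  classical
  induction s using Finset.induction_on with
  | empty => simpa using negligible_zero
  | insert i s hi ih => simpa [Finset.sum_insert hi] using (hf i).add ih

theorem negligible_div_two_pow (C : ℝ) : Negligible fun k => C / 2 ^ k := by
  intro m
  have h := (tendsto_pow_const_mul_const_pow_of_abs_lt_one m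
    (r := (1 / 2 : ℝ)) (by rw [abs_of_pos] <;> norm_num)).const_mul C
  rw [mul_zero] at h
  refine h.congr fun k => ?_
  rw [one_div, inv_pow]
  ring

/-- The advantage of a distinguisher is bounded by the distance of the two distributions. -/
def StatClose (C : ℝ) {k : ℕ} (X Y : KeyPair k → PMF (List ℕ)) : Prop :=
  ∀ (K : KeyPair k) (D : List ℕ → PMF State),
    |acceptProb ((X K).bind D) - acceptProb ((Y K).bind D)| ≤ C / 2 ^ k

section CompIndist

variable {X Y Z : (k : ℕ) → KeyPair k → PMF (List ℕ)}

theorem CompIndist.of_statClose {C : ℝ} (hC : 0 ≤ C) (h : ∀ᶠ k in atTop, StatClose C (X k) (Y k)) :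
    CompIndist X Y := by
  intro D z
  refine (negligible_div_two_pow C).mono ?_
  filter_upwards [h] with k hk
  rw [abs_abs]
  exact abs_keyAvg_sub_le (by positivity) fun K => hk K _

theorem CompIndist.of_eventually_eq (h : ∀ᶠ k in atTop, X k = Y k) : CompIndist X Y := by
  refine .of_statClose le_rfl (C := 0) ?_
  filter_upwards [h] with k hk K D
  rw [hk, sub_self, abs_zero, zero_div]

theorem CompIndist.trans (h₁ : CompIndist X Y) (h₂ : CompIndist Y Z) : CompIndist X Z := by
  intro D z
  refine ((h₁ D z).add (h₂ D z)).mono (Eventually.of_forall fun k => ?_)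
  rw [abs_abs]
  exact abs_sub_le _ _ _

/-- Indistinguishability for each member of a finite family implies indistinguishability for all
sequences of members. -/
theorem CompIndist.of_forall {β : Type} [Fintype β]
    {X Y : β → (k : ℕ) → KeyPair k → PMF (List ℕ)} (h : ∀ b, CompIndist (X b) (Y b)) (b : ℕ → β) :
    CompIndist (fun k => X (b k) k) (fun k => Y (b k) k) := by
  intro D z
  -- The advantage at `b k` is one of the summands, whichever sequence is chosen.
  refine (Negligible.sum Finset.univ fun b => h b D z).mono (Eventually.of_forall fun k => ?_)
  rw [abs_abs]
  refine Finset.single_le_sum (f := fun b =>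
    |keyAvg k (fun K => acceptProb ((X b k K).bind fun v => D.run (load (k :: z.val k :: v)))) -
      keyAvg k (fun K => acceptProb ((Y b k K).bind fun v => D.run (load (k :: z.val k :: v))))|)
    (fun _ _ => abs_nonneg _) (Finset.mem_univ (b k))

end CompIndist

/-! ## Replacing random units by random residues -/

section Sample

variable {k : ℕ} (K : KeyPair k) (G H E : Type)

/-- Random residues and random units, the latter in two groups. -/
abbrev Sample := (G → K.Plain) × (H → K.Nonce) × (E → K.Nonce)

variable {G H E}

/-- Units are residues. -/
def Sample.residues {K : KeyPair k} (w : Sample K G H E) : G ⊕ H ⊕ E → ZMod K.n :=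
  Sum.elim w.1 (Sum.elim (fun h => w.2.1 h) fun e => w.2.2 e)

theorem Sample.residues_injective : Function.Injective (Sample.residues (K := K) (G := G) (H := H)
    (E := E)) := by
  rintro ⟨g, h, e⟩ ⟨g', h', e'⟩ heq
  have h₁ := fun x => congrFun heq (.inl x)
  have h₂ := fun x => congrFun heq (.inr (.inl x))
  have h₃ := fun x => congrFun heq (.inr (.inr x))
  simp only [Sample.residues, Sum.elim_inl, Sum.elim_inr] at h₁ h₂ h₃
  refine Prod.ext (funext h₁) (Prod.ext (funext fun x => ?_) (funext fun x => ?_))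
  exacts [Units.ext (h₂ x), Units.ext (h₃ x)]

/-- φ(n)/n = (1 - 1/p)(1 - 1/q) ≥ 1 - 1/p - 1/q, and a prime of exactly k bits is at least 2^(k-1).
-/
theorem KeyPair.one_sub_totient_div_le : 1 - (K.n.totient : ℝ) / K.n ≤ 4 / 2 ^ k := by
  have hk : 1 ≤ k := by
    rw [← K.size_p]
    exact Nat.size_pos.2 K.prime_p.pos
  have hp : (1 : ℝ) ≤ K.p := by exact_mod_cast K.prime_p.one_le
  have hq : (1 : ℝ) ≤ K.q := by exact_mod_cast K.prime_q.one_le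
  have hp' : (2 : ℝ) ^ (k - 1) ≤ K.p := by exact_mod_cast K.pow_le_p
  have hq' : (2 : ℝ) ^ (k - 1) ≤ K.q := by exact_mod_cast K.pow_le_q
  have h2 : (4 : ℝ) / 2 ^ k = 1 / 2 ^ (k - 1) + 1 / 2 ^ (k - 1) := by
    obtain ⟨j, rfl⟩ := Nat.exists_eq_add_of_le' hk
    rw [Nat.add_sub_cancel, pow_succ]
    field_simp
    norm_num
  have h3 : (1 : ℝ) / K.p ≤ 1 / 2 ^ (k - 1) := one_div_le_one_div_of_le (by positivity) hp'
  have h4 : (1 : ℝ) / K.q ≤ 1 / 2 ^ (k - 1) := one_div_le_one_div_of_le (by positivity) hq'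
  have h5 : 1 - (K.n.totient : ℝ) / K.n ≤ 1 / K.p + 1 / K.q := by
    rw [K.totient_n, KeyPair.n, Nat.cast_mul, Nat.cast_mul, Nat.cast_sub K.prime_p.one_le,
      Nat.cast_sub K.prime_q.one_le, Nat.cast_one]
    have hp0 : (K.p : ℝ) ≠ 0 := by positivity
    have hq0 : (K.q : ℝ) ≠ 0 := by positivity
    rw [div_add_div _ _ hp0 hq0, sub_le_iff_le_add, ← add_div, le_div_iff₀ (by positivity)]
    nlinarith
  linarith

variable [Fintype G] [Fintype H] [Fintype E] [DecidableEq G] [DecidableEq H] [DecidableEq E]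

/-- The samples made of units have density (φ(n)/n)^T among all residue vectors, with T the number
of units; Bernoulli's inequality makes the defect at most T (1 - φ(n)/n). -/
theorem Sample.abs_expect_sub_le {f : (G ⊕ H ⊕ E → ZMod K.n) → ℝ} (h₀ : ∀ v, 0 ≤ f v)
    (h₁ : ∀ v, f v ≤ 1) :
    |𝔼 w : Sample K G H E, f w.residues - 𝔼 v, f v| ≤
      4 * (Fintype.card H + Fintype.card E : ℕ) / 2 ^ k := by
  refine (abs_expect_comp_sub_le (Sample.residues_injective K) h₀ h₁).trans ?_
  have hn : (0 : ℝ) < K.n := by exact_mod_cast K.n_pos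
  have hc : (Fintype.card (Sample K G H E) : ℝ) / Fintype.card (G ⊕ H ⊕ E → ZMod K.n) =
      ((K.n.totient : ℝ) / K.n) ^ (Fintype.card H + Fintype.card E) := by
    simp only [Fintype.card_prod, Fintype.card_fun, Fintype.card_sum, ZMod.card,
      ZMod.card_units_eq_totient, Nat.cast_mul, Nat.cast_pow, pow_add, div_pow]
    field_simp
  rw [hc]
  have ht : (K.n.totient : ℝ) / K.n ≤ 1 := by
    rw [div_le_one hn]
    exact_mod_cast Nat.totient_le _
  have ht₀ : 0 ≤ (K.n.totient : ℝ) / K.n := by positivity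
  have hb := one_add_mul_le_pow (a := (K.n.totient : ℝ) / K.n - 1) (by linarith)
    (Fintype.card H + Fintype.card E)
  rw [add_sub_cancel] at hb
  have := K.one_sub_totient_div_le
  have hT : (0 : ℝ) ≤ (Fintype.card H + Fintype.card E : ℕ) := Nat.cast_nonneg _
  rw [mul_comm (4 : ℝ), mul_div_assoc]
  nlinarith [mul_le_mul_of_nonneg_left this hT]

end Sample

/-! ## Security of several encryptions -/

/-- The data from which a view with encryptions is computed: the modulus and its square, random
residues, random units, and ciphertexts. -/
inductive Slot (G H E : Type)
  | modulus
  | modulusSq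
  | num (g : G)
  | unit (h : H)
  | cipher (e : E)

section

variable {G H E : Type}

/-- The values of all slots. -/
def slotEnv (n n₂ : ℕ) (v : G ⊕ H ⊕ E → ℕ) (c : E → ℕ) : Slot G H E → ℕ
  | .modulus => n
  | .modulusSq => n₂
  | .num g => v (.inl g)
  | .unit h => v (.inr (.inl h))
  | .cipher e => c e

variable [Fintype G] [Fintype H] [Fintype E] [DecidableEq G] [DecidableEq H] [DecidableEq E]

/-- What is computed by `F` from random numbers and from encryptions of the messages `msg`. -/
noncomputable def encView (F : (Slot G H E → ℕ) → List ℕ) (msg : E → ℕ) {k : ℕ} (K : KeyPair k) :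
    PMF (List ℕ) :=
  (PMF.uniformOfFintype (Sample K G H E)).map fun w =>
    F (slotEnv K.n (K.n ^ 2) (fun x => (w.residues x).val)
      fun e => (K.enc (msg e : ZMod K.n) (w.2.2 e)).val)

theorem expect_prod {A B : Type} [Fintype A] [Fintype B] (f : A × B → ℝ) :
    𝔼 x, f x = 𝔼 a, 𝔼 b, f (a, b) := by
  rw [← Finset.univ_product_univ, Finset.expect_product]

/-- Exchanging `r` with the coordinate `t` is an involution, hence preserves the uniform average. It
lets the challenger's nonce take the place of the nonce of ciphertext `t`. -/
theorem expect_resample {k : ℕ} (K : KeyPair k) (t : E) (φ : Sample K G H E → ℝ) :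
    𝔼 r : K.Nonce, 𝔼 w : Sample K G H E, φ (w.1, w.2.1, Function.update w.2.2 t r) =
      𝔼 w, φ w := by
  have hinv : Function.Involutive fun x : K.Nonce × Sample K G H E =>
      ((x.2.2.2 t, x.2.1, x.2.2.1, Function.update x.2.2.2 t x.1) : K.Nonce × Sample K G H E) := by
    rintro ⟨r, g, h, e⟩
    simp
  calc 𝔼 r : K.Nonce, 𝔼 w : Sample K G H E, φ (w.1, w.2.1, Function.update w.2.2 t r)
      = 𝔼 x : K.Nonce × Sample K G H E, φ (x.2.1, x.2.2.1, Function.update x.2.2.2 t x.1) := by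
        rw [expect_prod]
    _ = 𝔼 x : K.Nonce × Sample K G H E, φ x.2 := Fintype.expect_equiv hinv.toPerm _ _ fun _ => rfl
    _ = 𝔼 w, φ w := by
        rw [expect_prod]
        exact Finset.expect_const (Finset.univ_nonempty (α := K.Nonce)) (𝔼 w, φ w)

/-- Reduction: an adversary in the semantic security experiment that embeds the challenge as the
ciphertext `t` of the view. -/
theorem exists_reduction {F : (Slot G H E → ℕ) → List ℕ} (hF : ArithList F) (msg : E → ℕ) (t : E)
    (x : ℕ) (D : PPT) : ∃ A₁ A₂ : PPT, ∀ (z : Advice) (β : Bool) (k : ℕ) (K : KeyPair k),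
      |acceptProb ((encView F (Function.update msg t (if β then x else msg t)) K).bind fun v =>
          D.run (load (k :: z.val k :: v))) - acceptProb (challenge A₁ A₂ z β k K)| ≤
        4 * (Fintype.card H + Fintype.card E : ℕ) / 2 ^ k := by
  -- The first phase puts the two messages into registers 0 and 1 and moves the parameter, the
  -- advice, n and n² to registers 2 to 5, out of the way of the challenge.
  obtain ⟨c₁, hc₁, h₁⟩ := ArithList.exists_program
    (F := fun s => [msg t, x, s 0, s 1, s 2, s 3])
    (.cons (.const _) <| .cons (.const _) <| .cons (.var _) <| .cons (.var _) <|
      .cons (.var _) <| .cons (.var _) .nil) 4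
  obtain ⟨A₁, hA₁⟩ := hc₁.exists_ppt
  -- Ciphertext `t` is the challenge in register 0; all others are made by the adversary, with
  -- random residues as nonces.
  set σ : Slot G H E → (ℕ ⊕ (G ⊕ H ⊕ E) → ℕ) → ℕ := fun s ρ =>
    slotEnv (ρ (.inl 4)) (ρ (.inl 5)) (fun i => ρ (.inr i)) (fun e => if e = t then ρ (.inl 0) else
      encNat (ρ (.inl 4)) (ρ (.inl 5)) (msg e) (ρ (.inr (.inr (.inr e))))) s with hσ
  have hσ' : ∀ s, Arith (σ s) := by
    rintro (_ | _ | g | h | e)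
    · exact .var _
    · exact .var _
    · exact .var _
    · exact .var _
    · by_cases h : e = t
      · simpa [hσ, slotEnv, h] using Arith.var _
      · simpa [hσ, slotEnv, h] using Arith.encNat (.var _) (.var _) (.const _) (.var _)
  obtain ⟨c₂, hc₂, h₂⟩ := ArithList.exists_randomized
    (F := fun ρ => ρ (.inl 2) :: ρ (.inl 3) :: F fun s => σ s ρ)
    (.cons (.var _) <| .cons (.var _) (hF.subst hσ')) 6 4 (by norm_num)
  obtain ⟨A₂, hA₂⟩ := hc₂.exists_ppt_seq D
  refine ⟨A₁, A₂, fun z β k K => ?_⟩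
  set y : ℕ := if β then x else msg t with hy
  set f : K.Nonce → (G ⊕ H ⊕ E → ZMod K.n) → ℝ := fun r v =>
    acceptProb (D.run (load (k :: z.val k :: F (slotEnv K.n (K.n ^ 2) (fun i => (v i).val)
      fun e => if e = t then (K.enc (y : ZMod K.n) r).val else
        encNat K.n (K.n ^ 2) (msg e) (v (.inr (.inr e))).val)))) with hf
  have hch : acceptProb (challenge A₁ A₂ z β k K) = 𝔼 r, 𝔼 v, f r v := by
    have hs : ∀ u, (4 ≤ u) → load [k, z.val k, K.n, K.n ^ 2] u = 0 := fun u hu => load_eq_zero hu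
    rw [challenge, hA₁, h₁ _ hs, PMF.pure_bind, acceptProb_uniform_bind]
    refine Finset.expect_congr rfl fun r _ => ?_
    have hm : (if β = true then load [msg t, x, k, z.val k, K.n, K.n ^ 2] 1
        else load [msg t, x, k, z.val k, K.n, K.n ^ 2] 0) = y := by
      rw [hy]
      rfl
    have hu : ∀ c : ℕ, Function.update (load [msg t, x, k, z.val k, K.n, K.n ^ 2]) 0 c =
        load [c, x, k, z.val k, K.n, K.n ^ 2] := by
      intro c
      funext u
      rcases u with _ | u
      · rfl
      · rfl
    change acceptProb (A₂.run (Function.update (load [msg t, x, k, z.val k, K.n, K.n ^ 2]) 0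
      (K.enc ((if β = true then load [msg t, x, k, z.val k, K.n, K.n ^ 2] 1
        else load [msg t, x, k, z.val k, K.n, K.n ^ 2] 0 : ℕ) : ZMod K.n) r).val)) = _
    rw [hm, hu, hA₂, h₂ _ K.n rfl rfl, PMF.bind_map, acceptProb_uniform_bind]
    rfl
  have hview : acceptProb ((encView F (Function.update msg t y) K).bind fun v =>
      D.run (load (k :: z.val k :: v))) = 𝔼 r, 𝔼 w : Sample K G H E, f r w.residues := by
    rw [encView, PMF.bind_map, acceptProb_uniform_bind, ← expect_resample K t]
    refine Finset.expect_congr rfl fun r _ => Finset.expect_congr rfl fun w _ => ?_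
    simp only [hf, Function.comp_apply]
    congr 6
    funext s
    rcases s with _ | _ | g | h | e
    · rfl
    · rfl
    · rfl
    · rfl
    · by_cases he : e = t
      · subst he
        simp [slotEnv]
      · simp [slotEnv, he, KeyPair.enc_natCast_val, Sample.residues]
  rw [hch, hview]
  -- For each challenge nonce `r`, the two sides differ only in residues being drawn instead of
  -- units.
  exact abs_expect_sub_le fun r => Sample.abs_expect_sub_le K
    (fun v => acceptProb_nonneg _) fun v => acceptProb_le_one _

/-- Three steps: from the view to the experiment with `β = false`, by semantic security to `β =
true`, and back to the changed view. -/
theorem encView_update_indist (hsec : PaillierSemanticallySecure) {F : (Slot G H E → ℕ) → List ℕ}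
    (hF : ArithList F) (msg : E → ℕ) (t : E) (x : ℕ) :
    CompIndist (fun _ => encView F msg) (fun _ => encView F (Function.update msg t x)) := by
  intro D z
  obtain ⟨A₁, A₂, h⟩ := exists_reduction hF msg t x D
  set C : ℝ := 4 * (Fintype.card H + Fintype.card E : ℕ) with hC
  have hC₀ : 0 ≤ C := by positivity
  refine (((negligible_div_two_pow C).add (hsec A₁ A₂ z)).add (negligible_div_two_pow C)).mono
    (Eventually.of_forall fun k => ?_)
  have h₀ := abs_keyAvg_sub_le (by positivity) fun K : KeyPair k => h z false k K
  have h₁ := abs_keyAvg_sub_le (by positivity) fun K : KeyPair k => h z true k K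
  simp only [Bool.false_eq_true, if_false, if_true, Function.update_eq_self] at h₀ h₁
  rw [abs_abs]
  rw [abs_sub_comm] at h₁
  exact (abs_sub_le _ _ _).trans (add_le_add ((abs_sub_le _ _ _).trans (add_le_add h₀ le_rfl)) h₁)

/-- Views that are computed from encryptions of different messages are indistinguishable. -/
theorem encView_indist (hsec : PaillierSemanticallySecure) {F : (Slot G H E → ℕ) → List ℕ}
    (hF : ArithList F) (msg msg' : E → ℕ) :
    CompIndist (fun _ => encView F msg) (fun _ => encView F msg') := by
  -- Hybrids: the messages in `s` are already replaced. Their number does not grow with `k`.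
  have h : ∀ s : Finset E,
      CompIndist (fun _ => encView F msg) (fun _ => encView F (s.piecewise msg' msg)) := by
    intro s
    induction s using Finset.induction_on with
    | empty => exact .of_eventually_eq (by simp)
    | insert t s _ ih =>
      refine ih.trans ?_
      rw [Finset.piecewise_insert]
      exact encView_update_indist hsec hF _ t _
  simpa using h Finset.univ

/-! ## Simulators -/

theorem ofFn_load {l : List ℕ} {L : ℕ} (h : l.length = L) :
    (List.ofFn fun x : Fin L => load l x) = l := by
  subst h
  refine List.ext_getElem (by simp) fun i h₁ h₂ => ?_
  simp [load]

/-- A simulator that draws random residues instead of random units. -/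
theorem exists_simulator {F : (ℕ ⊕ (G ⊕ H ⊕ E) → ℕ) → List ℕ} (hF : ArithList F) (a y : ℕ)
    (hy : y < a) : ∃ (A : PPT) (L : ℕ), ∀ {k : ℕ} (l : KeyPair k → List ℕ),
      (∀ K, (l K).length = a) → (∀ K, load (l K) y = K.n) →
      StatClose (4 * (Fintype.card H + Fintype.card E : ℕ))
        (fun K => (PMF.uniformOfFintype (Sample K G H E)).map fun w =>
          F (Sum.elim (load (l K)) fun x => (w.residues x).val))
        (fun K => A.output L (l K)) := by
  obtain ⟨c, hc, h⟩ := hF.exists_randomized a y hy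
  obtain ⟨A, hA⟩ := hc.exists_ppt
  obtain ⟨fs, -, hfs⟩ := hF
  refine ⟨A, fs.length, fun {k} l hl hy K D => ?_⟩
  beta_reduce
  rw [PPT.output, hA, h (l K) K.n (hl K) (hy K), PMF.map_comp, PMF.bind_map, PMF.bind_map,
    acceptProb_uniform_bind, acceptProb_uniform_bind]
  have hlen : ∀ ρ, (F ρ).length = fs.length := fun ρ => by simp [hfs]
  simp only [Function.comp_def, ofFn_load (hlen _)]
  exact Sample.abs_expect_sub_le K (f := fun v => acceptProb (D (F (Sum.elim (load (l K))
    fun x => (v x).val)))) (fun v => acceptProb_nonneg _) fun v => acceptProb_le_one _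

end

/-! ## Correctness of the protocol -/

section Correctness

variable {k : ℕ} (K : KeyPair k) {N m S : ℕ} (b : Schedule N m) (w : Coins K N m)

/-- The scaled share of user `i` in timeslot `j`. -/
def amount (S : ℕ) (i : Fin N) (j : Fin m) : ℕ := if b i j then S / count b j else 0

/-- The randomness of the ciphertext that user `i` receives in the first stage. -/
def replyNonce (i : Fin N) (j : Fin m) : K.Nonce :=
  (∏ i', nonce₁ K w i' j) * maskNonce K w j * (nonce₁ K w i j)⁻¹ ^ (mask K w j).val

/-- The power of the inverse request contributes -b_i^j R^j to the plaintext, which cancels the mask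
exactly when b_i^j = 1. -/
theorem reply_eq (i : Fin N) (j : Fin m) :
    reply K b w i j = K.enc ((count b j : K.Plain) + if b i j then 0 else mask K w j)
      (replyNonce K w i j) := by
  have hsum : ∑ i', (if b i' j then (1 : K.Plain) else 0) = count b j := by
    rw [Finset.sum_boole, count]
  simp only [reply, request]
  rw [K.enc_prod, K.enc_mul, K.enc_inv, K.enc_pow, K.enc_mul, hsum, replyNonce, add_assoc]
  congr 2
  split <;> simp

theorem count_le (j : Fin m) : count b j ≤ N := by
  simpa [count] using Finset.card_filter_le (Finset.univ : Finset (Fin N)) fun i => b i j = true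

theorem count_pos {i : Fin N} {j : Fin m} (h : b i j = true) : 1 ≤ count b j :=
  Finset.card_pos.2 ⟨i, by simpa using h⟩

theorem card_users_le (hS : 0 < S) (hdvd : ∀ t : ℕ, 1 ≤ t → t ≤ N → t ∣ S) : N ≤ S := by
  rcases Nat.eq_zero_or_pos N with h | h
  · omega
  · exact Nat.le_of_dvd hS (hdvd N h le_rfl)

theorem received_eq (hS : 0 < S) (hdvd : ∀ t : ℕ, 1 ≤ t → t ≤ N → t ∣ S)
    (hk : S < 2 ^ (k - 1)) {i : Fin N} {j : Fin m} (h : b i j = true) :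
    received K b w i j = count b j := by
  rw [received, reply_eq, K.dec_enc, if_pos h, add_zero, ZMod.valMinAbs_natCast_of_le_half]
  have h₁ := count_le b j
  have h₂ := card_users_le hS hdvd
  have h₃ := K.pow_le_p
  have h₄ := K.prime_q.two_le
  -- The count is at most N ≤ S < p, and 2 ≤ q, so twice the count is at most n.
  rw [Nat.le_div_iff_mul_le two_pos, KeyPair.n]
  exact Nat.mul_le_mul (by omega) h₄

/-- Divisibility makes the scaled share an integer, so rounding down loses nothing. -/
theorem encode_share (hS : 0 < S) (hdvd : ∀ t : ℕ, 1 ≤ t → t ≤ N → t ∣ S)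
    (hk : S < 2 ^ (k - 1)) (i : Fin N) (j : Fin m) (u : ℕ) :
    encode S K.n ((if b i j then 1 / (received K b w i j : ℚ) else 0) + (u : ℚ)) =
      (amount b S i j : ZMod K.n) + (S * u : ℕ) := by
  have h : (S : ℚ) * ((if b i j then 1 / (received K b w i j : ℚ) else 0) + (u : ℚ)) =
      ((amount b S i j + S * u : ℕ) : ℤ) := by
    by_cases hb : b i j = true
    · have h₁ := count_pos b hb
      have h₂ : ((S / count b j : ℕ) : ℚ) = S / count b j :=
        Nat.cast_div (hdvd _ h₁ (count_le b j)) (by positivity)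
      simp only [hb, if_true, received_eq K b w hS hdvd hk hb, amount]
      rw [Int.cast_natCast, Int.cast_natCast, Nat.cast_add, h₂]
      push_cast
      ring
    · simp [hb, amount]
  rw [encode, h, Int.floor_intCast]
  push_cast
  ring

theorem contribution_eq (hS : 0 < S) (hdvd : ∀ t : ℕ, 1 ≤ t → t ≤ N → t ∣ S)
    (hk : S < 2 ^ (k - 1)) (i : Fin N) (j : Fin m) :
    contribution K S b w i j =
      K.enc ((amount b S i j : ZMod K.n) + (S * (userMask K w i j).val : ℕ)) (nonce₂ K w i j) := by
  rw [contribution, encode_share K b w hS hdvd hk]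

theorem sum_amount (hdvd : ∀ t : ℕ, 1 ≤ t → t ≤ N → t ∣ S) (j : Fin m) :
    ∑ i, amount b S i j = S * if occupancy b j then 1 else 0 := by
  have h : ∑ i, amount b S i j = count b j * (S / count b j) := by
    simp only [amount, count]
    rw [← Finset.sum_filter, Finset.sum_const, smul_eq_mul]
  by_cases hb : ∃ i, b i j = true
  · obtain ⟨i, hi⟩ := hb
    have : occupancy b j = true := by simpa [occupancy] using ⟨i, hi⟩
    rw [h, Nat.mul_div_cancel' (hdvd _ (count_pos b hi) (count_le b j)), this]
    simp
  · have h₁ : occupancy b j = false := by simpa [occupancy] using hb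
    have h₂ : count b j = 0 := by simpa [count] using hb
    simp [h, h₁, h₂]

theorem aggregate_eq (hS : 0 < S) (hdvd : ∀ t : ℕ, 1 ≤ t → t ≤ N → t ∣ S)
    (hk : S < 2 ^ (k - 1)) (j : Fin m) :
    aggregate K S b w j =
      K.enc ((S * ((if occupancy b j then 1 else 0) + ∑ i, (userMask K w i j).val) : ℕ) : ZMod K.n)
        (∏ i, nonce₂ K w i j) := by
  simp only [aggregate, contribution_eq K b w hS hdvd hk]
  rw [K.enc_prod, Nat.mul_add, ← sum_amount b hdvd, Finset.mul_sum, ← Finset.sum_add_distrib]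
  push_cast
  rfl

theorem opened_eq (hS : 0 < S) (hdvd : ∀ t : ℕ, 1 ≤ t → t ≤ N → t ∣ S)
    (hk : S < 2 ^ (k - 1)) (i : Fin N) (j : Fin m) :
    opened K S b w i j =
      ((S * ((if occupancy b j then 1 else 0) + ∑ i, (userMask K w i j).val) : ℕ) : ZMod K.n) := by
  rw [opened, aggregate_eq K b w hS hdvd hk, K.dec_enc]

theorem encode_natCast (n u : ℕ) : encode S n (u : ℚ) = ((S * u : ℕ) : ZMod n) := by
  have h : (S : ℚ) * (u : ℚ) = ((S * u : ℕ) : ℤ) := by push_cast; ring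
  rw [encode, h, Int.floor_intCast, Int.cast_natCast]

theorem operatorOutput_eq (hS : 0 < S) (hdvd : ∀ t : ℕ, 1 ≤ t → t ≤ N → t ∣ S)
    (hk : S < 2 ^ (k - 1)) (j : Fin m) : operatorOutput K S b w j = occupancy b j := by
  have hS' : (S : ZMod K.n) ≠ 0 := by
    rw [Ne, ZMod.natCast_eq_zero_iff]
    intro h
    have h₁ := Nat.le_of_dvd hS h
    have h₂ := K.pow_le_p
    have h₃ := Nat.le_mul_of_pos_right K.p K.prime_q.pos
    unfold KeyPair.n at h₁
    omega
  have h₁ : encode S K.n 1 = (S : ZMod K.n) := by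
    simpa using encode_natCast (S := S) K.n 1
  have h : ∀ i, opened K S b w i j - encode S K.n (∑ i', ((userMask K w i' j).val : ℚ)) =
      encode S K.n 1 ↔ occupancy b j = true := by
    intro i
    rw [opened_eq K b w hS hdvd hk, ← Nat.cast_sum, encode_natCast, h₁]
    cases occupancy b j <;> simp [mul_add, hS'.symm]
  simp only [operatorOutput, h]
  -- A requesting user also supplies the index demanded by `operatorOutput`; without users both
  -- sides are false.
  by_cases hb : ∃ i, b i j = true
  · obtain ⟨i, hi⟩ := hb
    have : occupancy b j = true := by simpa [occupancy] using ⟨i, hi⟩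
    simpa [this] using ⟨i⟩
  · have h₁ : occupancy b j = false := by simpa [occupancy] using hb
    simp [h₁]

theorem userOutput_eq (hS : 0 < S) (hdvd : ∀ t : ℕ, 1 ≤ t → t ≤ N → t ∣ S)
    (hk : S < 2 ^ (k - 1)) (i : Fin N) (j : Fin m) :
    userOutput K b w i j = Option.map Int.ofNat (share b i j) := by
  by_cases h : b i j = true
  · simp [userOutput, share, h, received_eq K b w hS hdvd hk h]
  · simp [userOutput, share, h]

end Correctness

/-! ## The operator's view -/

section Operator

variable {k : ℕ} (K : KeyPair k) (N m S : ℕ)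

/-- The coins of an execution as random residues and random units. The units are grouped into those
that the operator draws and those that the users draw, for the first and for the second stage. -/
def coinsEquiv : Coins K N m ≃ Sample K (Fin m ⊕ Fin N × Fin m) (Fin m) (Bool × Fin N × Fin m) where
  toFun w := (Sum.elim (mask K w) fun x => userMask K w x.1 x.2, maskNonce K w,
    fun x => if x.1 then nonce₂ K w x.2.1 x.2.2 else nonce₁ K w x.2.1 x.2.2)
  invFun w := ((fun j => w.1 (.inl j), w.2.1, fun i j => w.1 (.inr (i, j))),
    fun i => (fun j => w.2.2 (false, i, j), fun j => w.2.2 (true, i, j)))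
  left_inv w := rfl
  right_inv w := by
    refine Prod.ext (funext ?_) (Prod.ext rfl (funext ?_))
    · rintro (j | ⟨i, j⟩) <;> rfl
    · rintro ⟨_ | _, i, j⟩ <;> rfl

/-- The operator's view as a function of the ciphertexts he receives in the first stage, the
ciphertexts of the shares without masks, his masks, and the occupancy of the timeslots. -/
def operatorList
    (ρ : Slot (Fin m ⊕ Fin N × Fin m) (Fin m) (Bool × Fin N × Fin m) ⊕ Fin m → ℕ) : List ℕ :=
  [ρ (.inl .modulus), ρ (.inl .modulusSq)]
    ++ List.ofFn (fun j : Fin m => ρ (.inl (.num (.inl j))))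
    ++ List.ofFn (fun j : Fin m => ρ (.inl (.unit j)))
    ++ tableList (fun (i : Fin N) (j : Fin m) => ρ (.inl (.num (.inr (i, j)))))
    ++ tableList (fun (i : Fin N) (j : Fin m) => ρ (.inl (.cipher (false, i, j))))
    ++ tableList (fun (i : Fin N) (j : Fin m) =>
      shiftNat (ρ (.inl .modulus)) (ρ (.inl .modulusSq)) (ρ (.inl (.cipher (true, i, j))))
        (S * ρ (.inl (.num (.inr (i, j))))))
    ++ tableList (fun (_ : Fin N) (j : Fin m) =>
      modNat (S * (ρ (.inr j) + ∑ i : Fin N, ρ (.inl (.num (.inr (i, j)))))) (ρ (.inl .modulus)))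

theorem arithList_operatorList : ArithList (operatorList N m S) :=
  ((((((ArithList.cons (.var _) (.cons (.var _) .nil)).append
    (.ofFn fun _ => .var _)).append
    (.ofFn fun _ => .var _)).append
    (.table fun _ _ => .var _)).append
    (.table fun _ _ => .var _)).append
    (.table fun _ _ => .shiftNat (.var _) (.var _) (.var _) (.const_mul _ (.var _)))).append
    (.table fun _ _ => .modNat (.const_mul _ (.add (.var _) (.sum _ fun _ => .var _))) (.var _))

variable {N m S}

/-- The messages that the users encrypt, apart from the masks. -/
def plainMessage (S : ℕ) (b : Schedule N m) (x : Bool × Fin N × Fin m) : ℕ :=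
  if x.1 then amount b S x.2.1 x.2.2 else if b x.2.1 x.2.2 then 1 else 0

/-- The schedule enters only through encrypted messages and the occupancy: the opened values are
determined by the operator's own masks and the bits c^j. -/
theorem operatorTranscript_eq (hS : 0 < S) (hdvd : ∀ t : ℕ, 1 ≤ t → t ≤ N → t ∣ S)
    (hk : S < 2 ^ (k - 1)) (b : Schedule N m) (w : Coins K N m) :
    operatorTranscript K S b w = operatorList N m S (Sum.elim
      (slotEnv K.n (K.n ^ 2) (fun x => ((coinsEquiv K N m w).residues x).val) fun e =>
        (K.enc (plainMessage S b e : ZMod K.n) ((coinsEquiv K N m w).2.2 e)).val)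
      fun j => if occupancy b j then 1 else 0) := by
  have h₁ : ∀ i j, (request K b w i j).val = (K.enc (plainMessage S b (false, i, j) : ZMod K.n)
      ((coinsEquiv K N m w).2.2 (false, i, j))).val := by
    intro i j
    simp only [request, plainMessage, Bool.false_eq_true, if_false, Nat.cast_ite, Nat.cast_one,
      Nat.cast_zero]
    rfl
  have h₂ : ∀ i j, (contribution K S b w i j).val = shiftNat K.n (K.n ^ 2)
      (K.enc (plainMessage S b (true, i, j) : ZMod K.n)
      ((coinsEquiv K N m w).2.2 (true, i, j))).val (S * (userMask K w i j).val) := by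
    intro i j
    rw [contribution_eq K b w hS hdvd hk, K.enc_add_natCast_val]
    rfl
  have h₃ : ∀ i j, (opened K S b w i j).val = modNat (S * ((if occupancy b j then 1 else 0) +
      ∑ i, (userMask K w i j).val)) K.n := by
    intro i j
    rw [opened_eq K b w hS hdvd hk, K.natCast_val_eq_modNat]
  simp only [operatorTranscript, h₁, h₂, h₃]
  rfl

theorem operatorView_eq_encView (hS : 0 < S) (hdvd : ∀ t : ℕ, 1 ≤ t → t ≤ N → t ∣ S)
    (hk : S < 2 ^ (k - 1)) (b : Schedule N m) :
    operatorView S b K = encView (fun ρ => operatorList N m S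
      (Sum.elim ρ fun j => if occupancy b j then 1 else 0)) (plainMessage S b) K := by
  rw [operatorView, encView, ← map_uniform_equiv (coinsEquiv K N m), PMF.map_comp]
  congr 1
  funext w
  exact operatorTranscript_eq K hS hdvd hk b w

end Operator

/-! ### Construction of the operator's simulator. -/

theorem eventually_lt_two_pow (S : ℕ) : ∀ᶠ k in atTop, S < 2 ^ (k - 1) := by
  filter_upwards [eventually_ge_atTop (S + 1)] with k hk
  exact lt_of_lt_of_le Nat.lt_two_pow_self (Nat.pow_le_pow_right two_pos (by omega))

theorem load_append_ofFn {l : List ℕ} {n : ℕ} (f : Fin n → ℕ) (l' : List ℕ) {a : ℕ}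
    (ha : l.length = a) (j : Fin n) : load (l ++ List.ofFn f ++ l') (a + j) = f j := by
  subst ha
  rw [load_append_of_lt (by simp), load, List.getD_append_right _ _ _ _ (by simp)]
  simp

/-- The simulator for the operator encrypts zeros. -/
theorem exists_operator_simulator (N m S : ℕ) (hS : 0 < S)
    (hdvd : ∀ t : ℕ, 1 ≤ t → t ≤ N → t ∣ S) (hsec : PaillierSemanticallySecure) :
    ∃ (sim : PPT) (L : ℕ), ∀ b : ℕ → Schedule N m,
      CompIndist (fun k K => operatorView S (b k) K)
        (fun k K => operatorSim sim L (occupancy (b k)) K) := by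
  -- In the simulator's input, n and n² are in registers 1 and 2, and the bits c^j start at register
  -- 3.
  set σ : Slot (Fin m ⊕ Fin N × Fin m) (Fin m) (Bool × Fin N × Fin m) ⊕ Fin m →
      (ℕ ⊕ ((Fin m ⊕ Fin N × Fin m) ⊕ Fin m ⊕ (Bool × Fin N × Fin m)) → ℕ) → ℕ := fun s ρ =>
    Sum.elim (slotEnv (ρ (.inl 1)) (ρ (.inl 2)) (fun i => ρ (.inr i))
      fun e => encNat (ρ (.inl 1)) (ρ (.inl 2)) 0 (ρ (.inr (.inr (.inr e)))))
      (fun j : Fin m => ρ (.inl (3 + j))) s with hσ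
  have hσ' : ∀ s, Arith (σ s) := by
    rintro ((_ | _ | g | h | e) | j)
    · exact .var _
    · exact .var _
    · exact .var _
    · exact .var _
    · exact .encNat (.var _) (.var _) (.const _) (.var _)
    · exact .var _
  obtain ⟨sim, L, hsim⟩ := exists_simulator ((arithList_operatorList N m S).subst hσ') (3 + m) 1
    (by omega)
  refine ⟨sim, L, fun b => CompIndist.of_forall (X := fun b k K => operatorView S b K)
    (Y := fun b k K => operatorSim sim L (occupancy b) K) (fun b => ?_) b⟩
  -- With `b` fixed the occupancy bits are constants, so the reduction may have them built in. The
  -- simulator was chosen before `b` and reads them from its input.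
  set F : (Slot (Fin m ⊕ Fin N × Fin m) (Fin m) (Bool × Fin N × Fin m) → ℕ) → List ℕ :=
    fun ρ => operatorList N m S (Sum.elim ρ fun j => if occupancy b j then 1 else 0) with hF
  have hF' : ArithList F := by
    refine (arithList_operatorList N m S).subst
      (σ := fun s ρ => Sum.elim ρ (fun j => if occupancy b j then 1 else 0) s) ?_
    rintro (s | j)
    · exact .var _
    · exact .const _
  have h₁ : CompIndist (fun k K => operatorView S b K) (fun k K => encView F (plainMessage S b) K) :=
    .of_eventually_eq <| by
      filter_upwards [eventually_lt_two_pow S] with k hk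
      funext K
      exact operatorView_eq_encView K hS hdvd hk b
  refine (h₁.trans (encView_indist hsec hF' _ fun _ => 0)).trans ?_
  refine .of_statClose (C := 4 * (Fintype.card (Fin m) + Fintype.card (Bool × Fin N × Fin m) : ℕ))
    (by positivity) (Eventually.of_forall fun k => ?_)
  have h := hsim (k := k) (fun K => [k, K.n, K.n ^ 2] ++ List.ofFn fun j =>
    if occupancy b j then 1 else 0) (fun K => by simp; ring) fun K => rfl
  convert h using 1
  swap
  · rfl
  funext K
  rw [encView]
  congr 1
  funext w
  simp only [hF, hσ]
  congr 1
  funext s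
  rcases s with ((_ | _ | g | h | e) | j)
  · rfl
  · rfl
  · rfl
  · rfl
  · simp only [Sum.elim_inl, slotEnv]
    rw [K.enc_natCast_val]
    rfl
  · simp only [Sum.elim_inr, Sum.elim_inl]
    simpa using (load_append_ofFn (l := [k, K.n, K.n ^ 2])
      (fun j => if occupancy b j then 1 else 0) [] rfl j).symm

/-! ## The view of a user -/

section User

variable {k : ℕ} (K : KeyPair k) {N m : ℕ} (S : ℕ) (b : Schedule N m)

/-- Coins in which the mask and the randomness of the operator in the first stage are replaced by
what user `i` sees of them. -/
def replyCoins (i : Fin N) (w : Coins K N m) : Coins K N m :=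
  ((fun j => (if b i j then 0 else (count b j : K.Plain)) + mask K w j, replyNonce K w i, w.1.2.2),
    w.2)

/-- Coins in which the mask and the randomness of user `i` in the second stage are replaced by what
the other users see of them. -/
def aggregateCoins (i : Fin N) (w : Coins K N m) : Coins K N m :=
  ((w.1.1, w.1.2.1, Function.update w.1.2.2 i fun j =>
      ((S * ((if occupancy b j then 1 else 0) + ∑ i', (userMask K w i' j).val) : ℕ) : K.Plain)),
    Function.update w.2 i ((w.2 i).1, fun j => ∏ i', nonce₂ K w i' j))

/-- The masks are shifted by constants and can be recovered; then the operator's nonces are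
multiplied by units that the masks and the unchanged user coins determine. -/
theorem replyCoins_injective (i : Fin N) : Function.Injective (replyCoins K b i (m := m)) := by
  rintro ⟨⟨M, ρ, U⟩, u⟩ ⟨⟨M', ρ', U'⟩, u'⟩ h
  simp only [replyCoins, Prod.mk.injEq] at h
  obtain ⟨⟨h₁, h₂, rfl⟩, rfl⟩ := h
  obtain rfl : M = M' := by
    funext j
    simpa [mask] using congrFun h₁ j
  obtain rfl : ρ = ρ' := by
    funext j
    simpa [replyNonce, nonce₁, maskNonce, mask] using congrFun h₂ j
  rfl

/-- Only the coins of `i` change. His mask is recovered by cancelling S and the unchanged masks of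
the others, his nonce by dividing out theirs. -/
theorem aggregateCoins_injective (hS : IsUnit (S : ZMod K.n)) (i : Fin N) :
    Function.Injective (aggregateCoins K S b i (m := m)) := by
  rintro ⟨⟨M, ρ, U⟩, u⟩ ⟨⟨M', ρ', U'⟩, u'⟩ h
  simp only [aggregateCoins, Prod.mk.injEq] at h
  obtain ⟨⟨rfl, rfl, h₁⟩, h₂⟩ := h
  have hU : ∀ i', i' ≠ i → U i' = U' i' := fun i' hi => by
    simpa [Function.update_of_ne hi] using congrFun h₁ i'
  have hu : ∀ i', i' ≠ i → u i' = u' i' := fun i' hi => by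
    simpa [Function.update_of_ne hi] using congrFun h₂ i'
  have hUi : U i = U' i := by
    funext j
    have h := congrFun (congrFun h₁ i) j
    simp only [Function.update_self, userMask, Nat.cast_mul, Nat.cast_add, Nat.cast_sum,
      ZMod.natCast_zmod_val] at h
    have h' := add_left_cancel (hS.mul_left_cancel h)
    rw [← sub_eq_zero, ← Finset.sum_sub_distrib, Finset.sum_eq_single i] at h'
    · exact sub_eq_zero.1 h'
    · intro i' _ hi
      rw [hU i' hi, sub_self]
    · simp
  have hui : u i = u' i := by
    have h := congrFun h₂ i
    simp only [Function.update_self, Prod.mk.injEq] at h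
    refine Prod.ext h.1 (funext fun j => ?_)
    have h' := congrFun h.2 j
    simp only [nonce₂] at h'
    rw [← div_eq_one, ← Finset.prod_div_distrib, Finset.prod_eq_single i] at h'
    · exact div_eq_one.1 h'
    · intro i' _ hi
      rw [hu i' hi, div_self']
    · simp
  have h₃ : U = U' := funext fun i' => if hi : i' = i then hi ▸ hUi else hU i' hi
  have h₄ : u = u' := funext fun i' => if hi : i' = i then hi ▸ hui else hu i' hi
  rw [h₃, h₄]

theorem KeyPair.isUnit_natCast (hS : 0 < S) (hk : S < 2 ^ (k - 1)) : IsUnit (S : ZMod K.n) := by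
  rw [ZMod.isUnit_iff_coprime, KeyPair.n]
  have hp := K.pow_le_p
  have hq := K.pow_le_q
  exact Nat.Coprime.mul_right
    (Nat.coprime_of_lt_prime hS.ne' (by omega) K.prime_p).symm
    (Nat.coprime_of_lt_prime hS.ne' (by omega) K.prime_q).symm

/-- Coins in which what user `i` sees of the coins of the others is split off: in the second stage,
it is stored as the coins of the user `i₀`, if that is another user. -/
def visibleCoins (i i₀ : Fin N) (w : Coins K N m) : Coins K N m :=
  if i₀ = i then replyCoins K b i w else aggregateCoins K S b i₀ (replyCoins K b i w)

theorem visibleCoins_injective (hS : IsUnit (S : ZMod K.n)) (i i₀ : Fin N) :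
    Function.Injective (visibleCoins K S b i i₀ (m := m)) := by
  unfold visibleCoins
  split
  · exact replyCoins_injective K b i
  · exact (aggregateCoins_injective K S b hS i₀).comp (replyCoins_injective K b i)

variable (N m)

/-- The view of user `i` as a function of random residues and units and of the list of the security
parameter, the keys, the user's schedule and the user's results. -/
def userList (i i₀ : Fin N)
    (ρ : ℕ ⊕ ((Fin m ⊕ Fin N × Fin m) ⊕ Fin m ⊕ Bool × Fin N × Fin m) → ℕ) : List ℕ :=
  [ρ (.inl 1), ρ (.inl 2), ρ (.inl 3), ρ (.inl 4)]
    ++ List.ofFn (fun j : Fin m => ρ (.inl (5 + j)))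
    ++ List.ofFn (fun j : Fin m => ρ (.inr (.inr (.inr (false, i, j)))))
    ++ List.ofFn (fun j : Fin m => ρ (.inr (.inr (.inr (true, i, j)))))
    ++ List.ofFn (fun j : Fin m => encNat (ρ (.inl 1)) (ρ (.inl 2))
      -- With request bit 1 this is the result alone. With bit 0 the result is stored as 0, and the
      -- plaintext is the uniform mask into which the count has been absorbed.
      (ρ (.inl (5 + m + j)) + if ρ (.inl 1) = 0 then 0 else
        (1 - ρ (.inl (5 + j))) * ρ (.inr (.inl (.inl j))) % ρ (.inl 1))
      (ρ (.inr (.inr (.inl j)))))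
    ++ List.ofFn (fun j : Fin m => ρ (.inr (.inl (.inr (i, j)))))
    ++ List.ofFn (fun j : Fin m => encNat (ρ (.inl 1)) (ρ (.inl 2))
      -- For a lone user the occupancy is his own bit and the only mask is his own. Otherwise the
      -- mask stored at `i₀` is already the whole aggregate plaintext.
      (if i₀ = i then S * (ρ (.inl (5 + j)) + ρ (.inr (.inl (.inr (i, j)))))
        else ρ (.inr (.inl (.inr (i₀, j)))))
      (ρ (.inr (.inr (.inr (true, i₀, j))))))

theorem arithList_userList (i i₀ : Fin N) : ArithList (userList N m S i i₀) :=
  ((((((ArithList.cons (.var _) (.cons (.var _) (.cons (.var _) (.cons (.var _) .nil)))).append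
    (.ofFn fun _ => .var _)).append
    (.ofFn fun _ => .var _)).append
    (.ofFn fun _ => .var _)).append
    (.ofFn fun _ => .encNat (.var _) (.var _)
      (.add (.var _) (.mulMod (.sub (.const 1) (.var _)) (.var _) (.var _))) (.var _))).append
    (.ofFn fun _ => .var _)).append
    (.ofFn fun _ => .encNat (.var _) (.var _) (by
      split
      · exact .const_mul _ (.add (.var _) (.var _))
      · exact .var _) (.var _))

variable {N m}

/-- The input of the simulator. -/
def userInput (u : Fin m → Bool) (a : Fin m → Option ℕ) : List ℕ :=
  [k, K.n, K.n ^ 2, K.p, K.q] ++ List.ofFn (fun j => if u j then 1 else 0)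
    ++ List.ofFn fun j => (a j).getD 0

/-- The hypothesis `hi` permits `i₀ = i` only when there is no other user. In the other case the
second-stage change of coordinates is made at `i₀ ≠ i` and leaves the coins of `i` and the masks
sent to him intact. -/
theorem userTranscript_eq (hS : 0 < S) (hdvd : ∀ t : ℕ, 1 ≤ t → t ≤ N → t ∣ S)
    (hk : S < 2 ^ (k - 1)) (i i₀ : Fin N) (hi : i₀ = i → ∀ i', i' = i) (w : Coins K N m) :
    userTranscript K S b i w = userList N m S i i₀ (Sum.elim
      (load (userInput K (b i) (share b i)))
      fun x => ((coinsEquiv K N m (visibleCoins K S b i i₀ w)).residues x).val) := by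
  set v := visibleCoins K S b i i₀ w with hv
  set l := userInput K (b i) (share b i) with hl
  have hl₁ : ∀ j : Fin m, load l (5 + j) = if b i j then 1 else 0 := fun j =>
    load_append_ofFn (l := [k, K.n, K.n ^ 2, K.p, K.q]) (fun j => if b i j then 1 else 0) _ rfl j
  have hl₂ : ∀ j : Fin m, load l (5 + m + j) = (share b i j).getD 0 := fun j => by
    have h := load_append_ofFn (l := [k, K.n, K.n ^ 2, K.p, K.q] ++
      List.ofFn fun j => if b i j then 1 else 0) (fun j => (share b i j).getD 0) []
      (a := 5 + m) (by simp; ring) j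
    rwa [List.append_nil] at h
  have hn₁ : ∀ j, nonce₁ K w i j = nonce₁ K v i j := fun j => by
    simp only [hv, visibleCoins, nonce₁]
    split
    · rfl
    · next h => simp [aggregateCoins, replyCoins, Function.update_of_ne (Ne.symm h)]
  have hn₂ : ∀ j, nonce₂ K w i j = nonce₂ K v i j := fun j => by
    simp only [hv, visibleCoins, nonce₂]
    split
    · rfl
    · next h => simp [aggregateCoins, replyCoins, Function.update_of_ne (Ne.symm h)]
  have hU : ∀ j, userMask K w i j = userMask K v i j := fun j => by
    simp only [hv, visibleCoins, userMask]
    split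
    · rfl
    · next h => simp [aggregateCoins, replyCoins, Function.update_of_ne (Ne.symm h)]
  have hM : ∀ j, mask K v j = (if b i j then 0 else (count b j : K.Plain)) + mask K w j :=
    fun j => by
      simp only [hv, visibleCoins]
      split <;> rfl
  have hρ : ∀ j, maskNonce K v j = replyNonce K w i j := fun j => by
    simp only [hv, visibleCoins]
    split <;> rfl
  have hreply : ∀ j, (reply K b w i j).val = encNat K.n (K.n ^ 2)
      (load l (5 + m + j) + if K.n = 0 then 0 else
        (1 - load l (5 + j)) * (mask K v j).val % K.n) (maskNonce K v j : ZMod K.n).val := by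
    intro j
    rw [← K.enc_natCast_val, reply_eq, hρ, hl₁, hl₂, if_neg K.n_pos.ne']
    congr 2
    by_cases hb : b i j = true
    · simp [hb, share]
    · simp [hb, share, hM]
  have hagg : ∀ j, (aggregate K S b w j).val = encNat K.n (K.n ^ 2)
      (if i₀ = i then S * (load l (5 + j) + (userMask K v i j).val)
        else (userMask K v i₀ j).val) (nonce₂ K v i₀ j : ZMod K.n).val := by
    intro j
    rw [← K.enc_natCast_val, aggregate_eq K b w hS hdvd hk, hl₁]
    by_cases h : i₀ = i
    · subst h
      have huniv : (Finset.univ : Finset (Fin N)) = {i₀} := by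
        ext i'
        simpa using hi rfl i'
      have hocc : occupancy b j = b i₀ j := by
        have : (∃ i', b i' j = true) ↔ b i₀ j = true :=
          ⟨fun ⟨i', h⟩ => hi rfl i' ▸ h, fun h => ⟨i₀, h⟩⟩
        simp [occupancy, this]
      rw [huniv, Finset.sum_singleton, Finset.prod_singleton, hocc, hU, hn₂, if_pos rfl]
    · have h₁ : userMask K v i₀ j = ((S * ((if occupancy b j then 1 else 0) +
          ∑ i', (userMask K w i' j).val) : ℕ) : K.Plain) := by
        simp only [hv, visibleCoins, if_neg h]
        simp [aggregateCoins, userMask, replyCoins]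
      have h₂ : nonce₂ K v i₀ j = ∏ i', nonce₂ K w i' j := by
        simp only [hv, visibleCoins, if_neg h]
        simp [aggregateCoins, nonce₂, replyCoins]
      rw [if_neg h, ZMod.natCast_zmod_val, h₁, h₂]
  have hb : ∀ j, (if b i j then 1 else 0) = load l (5 + j) := fun j => (hl₁ j).symm
  simp only [userTranscript, hreply, hagg, hn₁, hn₂, hU, hb]
  rfl

theorem userView_eq (hS : 0 < S) (hdvd : ∀ t : ℕ, 1 ≤ t → t ≤ N → t ∣ S)
    (hk : S < 2 ^ (k - 1)) (i i₀ : Fin N) (hi : i₀ = i → ∀ i', i' = i) :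
    userView S b i K = (PMF.uniformOfFintype
      (Sample K (Fin m ⊕ Fin N × Fin m) (Fin m) (Bool × Fin N × Fin m))).map fun w =>
        userList N m S i i₀ (Sum.elim (load (userInput K (b i) (share b i)))
          fun x => (w.residues x).val) := by
  -- An injective self-map of the finite set of coins is a permutation, so it preserves the uniform
  -- distribution.
  have hbij := Finite.injective_iff_bijective.1
    (visibleCoins_injective K S b (K.isUnit_natCast S hS hk) i i₀ (m := m))
  rw [← map_uniform_equiv (coinsEquiv K N m),
    ← map_uniform_equiv (Equiv.ofBijective _ hbij), PMF.map_comp, PMF.map_comp, userView]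
  congr 1
  funext w
  exact userTranscript_eq K S b hS hdvd hk i i₀ hi w

end User

/-- The simulator for a user draws what the user sees of the coins of the others. -/
theorem exists_user_simulator (N m S : ℕ) (hS : 0 < S)
    (hdvd : ∀ t : ℕ, 1 ≤ t → t ≤ N → t ∣ S) (i : Fin N) :
    ∃ (sim : PPT) (L : ℕ), ∀ b : ℕ → Schedule N m,
      CompIndist (fun k K => userView S (b k) i K)
        (fun k K => userSim sim L (b k i) (share (b k) i) K) := by
  obtain ⟨i₀, hi⟩ : ∃ i₀ : Fin N, i₀ = i → ∀ i', i' = i := by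
    by_cases h : ∃ i₀ : Fin N, i₀ ≠ i
    · obtain ⟨i₀, h⟩ := h
      exact ⟨i₀, fun h' => absurd h' h⟩
    · exact ⟨i, fun _ => by simpa using h⟩
  obtain ⟨sim, L, hsim⟩ := exists_simulator (arithList_userList N m S i i₀) (5 + m + m) 1 (by omega)
  -- The only loss is in drawing residues for units, and its bound does not depend on the schedule,
  -- so sequences of schedules are handled directly.
  refine ⟨sim, L, fun b => .of_statClose (C := 4 * (Fintype.card (Fin m) +
    Fintype.card (Bool × Fin N × Fin m) : ℕ)) (by positivity) ?_⟩
  filter_upwards [eventually_lt_two_pow S] with k hk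
  have h := hsim (k := k) (fun K => userInput K (b k i) (share (b k) i))
    (fun K => by simp [userInput]; ring) fun K => rfl
  convert h using 1
  · funext K
    exact userView_eq K S (b k) hS hdvd hk i i₀ hi
  · rfl

end PPUFS

theorem theorem1 (N m S : ℕ) (hS : 0 < S) (hdvd : ∀ t : ℕ, 1 ≤ t → t ≤ N → t ∣ S)
    (hsec : PPUFS.PaillierSemanticallySecure) :
    (∀ (k : ℕ), S < 2 ^ (k - 1) → ∀ (K : PPUFS.KeyPair k) (b : PPUFS.Schedule N m)
      (w : PPUFS.Coins K N m),
        (∀ j, PPUFS.operatorOutput K S b w j = PPUFS.occupancy b j) ∧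
        (∀ i j, PPUFS.userOutput K b w i j = Option.map Int.ofNat (PPUFS.share b i j))) ∧
    (∃ (sim : PPUFS.PPT) (L : ℕ), ∀ b : ℕ → PPUFS.Schedule N m,
      PPUFS.CompIndist
        (fun k K => PPUFS.operatorView S (b k) K)
        (fun k K => PPUFS.operatorSim sim L (PPUFS.occupancy (b k)) K)) ∧
    (∀ i : Fin N, ∃ (sim : PPUFS.PPT) (L : ℕ), ∀ b : ℕ → PPUFS.Schedule N m,
      PPUFS.CompIndist
        (fun k K => PPUFS.userView S (b k) i K)
        (fun k K => PPUFS.userSim sim L (b k i) (PPUFS.share (b k) i) K)) :=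
  ⟨fun _ hk K b w => ⟨PPUFS.operatorOutput_eq K b w hS hdvd hk,
      PPUFS.userOutput_eq K b w hS hdvd hk⟩,
    PPUFS.exists_operator_simulator N m S hS hdvd hsec,
    PPUFS.exists_user_simulator N m S hS hdvd⟩
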